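/- Let $j=e^{2i\pi/3}$, $\lambda=2(3\sqrt3)^{-1/2}$, $B_2=\lambda i$, $B_1=j^2B_2$, $B_3=jB_2$, and let $\mathbb T\subset\mathbb C$ be the (closed, equilateral, unit-area) triangle with vertices $B_1,B_2,B_3$. Let $D_1=\{ijt:t<0\}$ and $D_l=\{ij^lt:t\le0\}$ for $l=2,3$, and let $\mathbb T_l=\{x\in\mathbb T:|x-B_l|=\min_{1\le m\le3}|x-B_m|\}\setminus D_l$ for $l=1,2,3$. Let $c:\mathbb T\to[0,\infty)$ be measurable and bounded, and put $c_1(x)=c(x)$, $c_2(x)=c(j^2x)$, $c_3(x)=c(jx)$. Assume that (a) for all $x\in\mathbb T$ and $l=2,3$, if $|x-B_1|<|x-B_l|$ then $c_1(x)<c_l(x)$; (b) $c(te^{i\theta})=c(te^{-i\theta-i\pi/3})$ for all $\theta\in[0,2\pi]$ and $t>0$ with $te^{i\theta}\in\mathbb T$, and $c$ is Lipschitz on the intersection of $\mathbb T$ with an open neighbourhood of $D_1\cup D_3$; (c) $c$ does not vanish identically on $\mathbb T\cap D_1$. Let $X_1,X_2,\dots$ be independent random variables, uniformly distributed on $\mathbb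 T$. For $n\ge1$ let $\mathcal A_n$ be the set of matrices $A=(a_{kl})_{1\le k\le n,1\le l\le3}$ with entries in $\{0,1\}$ and $a_{k1}+a_{k2}+a_{k3}=1$ for all $k$, let $\rho_n(A)=\max_{1\le l\le3}\sum_{k=1}^na_{kl}c_l(X_k)$, $\rho_n=\min_{A\in\mathcal A_n}\rho_n(A)$, and $\overline\rho_n=\rho_n(\overline A)$ with $\overline a_{kl}=\mathbf 1\{X_k\in\mathbb T_l\}$. Put $\gamma=\int_{\mathbb T_1}c(x)\,dx$ and $\sigma^2=\int_{\mathbb T_1}c(x)^2\,dx$ with $\sigma\ge 0$. Then $\sigma^2/3-\gamma^2\ge0$. Let $G$ be Gaussian with mean zero and variance $\sigma^2/3-\gamma^2$, and let $G_1,G_2,G_3$ be independent Gaussian random variables with mean zero and variance $\sigma^2$, independent of $G$. As $n\to\infty$, $$n^{-1/2}(\rho_n-\gamma n)\xrightarrow{d}G,$$ $$n^{-1/2}(\overline\rho_n-\gamma n)\xrightarrow{d}\max\{G_1,G_2,G_3\}-\tfrac13(G_1+G_2+G_3)+G,$$ $$n^{-1/2}(\overline\rho_n-\rho_n)\xrightarrow{d}\max\{G_1,G_2,G_3\}-\tfrac13(G_1+G_2+G_3).$$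 Finally $\rho_n$, $\overline\rho_n$ and $\max\{G_1,G_2,G_3\}$ are integrable, and $$\mathrm E[\rho_n]=n\gamma+o(\sqrt n),\qquad \mathrm E[\overline\rho_n]=n\gamma+m\sqrt n+o(\sqrt n),$$ where $m=\mathrm E[\max\{G_1,G_2,G_3\}]>0$ depends linearly on $\sigma$: $m=\kappa\sigma$, where $\kappa$ is the mean of the maximum of three independent standard normal variables. -/

import Mathlib

open MeasureTheory ProbabilityTheory Filter Asymptotics

namespace PlanarLoad

noncomputable section

/-- The circumradius `λ = 2 (3 √3)^{-1/2}` of the equilateral triangle of unit area. -/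
def circumradius : ℝ := 2 / √(3 * √3)

/-- The primitive cube root of unity `j = e^{2iπ/3}`. -/
def j : ℂ := Complex.exp (2 * Real.pi * Complex.I / 3)

/-- The positions `B₁ = j² B₂`, `B₂ = λ i`, `B₃ = j B₂` of the three bins
(indexed here by `0, 1, 2`). -/
def bin : Fin 3 → ℂ :=
  ![j ^ 2 * (circumradius * Complex.I), circumradius * Complex.I,
    j * (circumradius * Complex.I)]

/-- The closed triangle `𝕋` with vertices `B₁`, `B₂`, `B₃`. -/
def triangle : Set ℂ := convexHull ℝ (Set.range bin)

/-- The half-lines `D₁ = {i j t : t < 0}`, `D₂ = {i j² t : t ≤ 0}`, `D₃ = {i j³ t : t ≤ 0}`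
that separate the cells. -/
def ray : Fin 3 → Set ℂ :=
  ![{z | ∃ t : ℝ, t < 0 ∧ z = Complex.I * j * t},
    {z | ∃ t : ℝ, t ≤ 0 ∧ z = Complex.I * j ^ 2 * t},
    {z | ∃ t : ℝ, t ≤ 0 ∧ z = Complex.I * j ^ 3 * t}]

/-- The Voronoi cell `𝕋_l` of the bin at `B_l` in the triangle. -/
def cell (l : Fin 3) : Set ℂ :=
  {x | x ∈ triangle ∧ ∀ m : Fin 3, ‖x - bin l‖ ≤ ‖x - bin m‖} \ ray l

/-- The costs `c₁(x) = c(x)`, `c₂(x) = c(j² x)`, `c₃(x) = c(j x)` of allocating an object at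
`x` to the three bins. -/
def cost (c : ℂ → ℝ) (l : Fin 3) (x : ℂ) : ℝ :=
  ![c x, c (j ^ 2 * x), c (j * x)] l

/-- The set `𝒜_n` of allocation matrices. -/
def allocations (n : ℕ) : Set (Matrix (Fin n) (Fin 3) ℝ) :=
  {A | (∀ k l, A k l = 0 ∨ A k l = 1) ∧ ∀ k, A k 0 + A k 1 + A k 2 = 1}

/-- The load `ρ_n(A) = max_l ∑_k a_{kl} c_l(x_k)` of the matrix `A` for objects at the
positions `x`. -/
def load (c : ℂ → ℝ) {n : ℕ} (A : Matrix (Fin n) (Fin 3) ℝ) (x : Fin n → ℂ) : ℝ :=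
  Finset.univ.sup' Finset.univ_nonempty fun l : Fin 3 => ∑ k, A k l * cost c l (x k)

/-- The optimal load `ρ_n`, the minimum of `ρ_n(A)` over the finite nonempty set `𝒜_n`. -/
def optimalLoad (c : ℂ → ℝ) {n : ℕ} (x : Fin n → ℂ) : ℝ :=
  sInf ((fun A => load c A x) '' allocations n)

/-- The matrix that allocates each object to the bin in whose cell it lies. -/
def cellMatrix {n : ℕ} (x : Fin n → ℂ) : Matrix (Fin n) (Fin 3) ℝ :=
  fun k l => (cell l).indicator (fun _ => 1) (x k)

/-- The suboptimal load, that of the allocation to the least costly bin. -/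
def suboptimalLoad (c : ℂ → ℝ) {n : ℕ} (x : Fin n → ℂ) : ℝ :=
  load c (cellMatrix x) x

/-- `γ = ∫_{𝕋₁} c(x) dx`. -/
def gammaConst (c : ℂ → ℝ) : ℝ := ∫ x in cell 0, c x

/-- `σ² = ∫_{𝕋₁} c(x)² dx`. -/
def sigmaSq (c : ℂ → ℝ) : ℝ := ∫ x in cell 0, c x ^ 2

/-- The mean of the maximum of three independent standard normal variables: a numerical
constant, independent of the cost function. -/
def stdNormalMaxMean : ℝ :=
  ∫ g : Fin 3 → ℝ, max (max (g 0) (g 1)) (g 2) ∂(Measure.pi fun _ => gaussianReal 0 1)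

end

end PlanarLoad

/-! Write `S l` for the total cost, to bin `l`, of the objects lying in its own cell. These are the
loads of the suboptimal allocation, so that load is the maximum of the `S l`. Nearer bins are
cheaper, with equality of cost on the common boundaries by the reflection symmetry, so this
allocation minimizes the sum of the three loads. Since a maximum is at least a mean, the optimal
load is at least `(S 0 + S 1 + S 2) / 3`.

This bound is attained up to `o(√n)` on average. The three sums differ by `O(√n)`, whereas order `n`
objects lie so close to the boundary of cells `l` and `m` that bin `m` costs at most `η` more than
bin `l`, while bin `l` costs at least a fixed `δ > 0`. Moving `O(√n / δ)` of them equalizes the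
loads with an error `O(1) + O(η √n / δ)` (`exists_rebalanced_allocation`). The strips have positive
area for every `η > 0` with the same `δ` (`exists_volume_strip_pos`), so `η` may be taken
arbitrarily small after `n → ∞`. Configurations where the strips hold too few objects are controlled
by second moments (`optimalLoad_sub_mean_le`, `isLittleO_integral_optimalLoad_sub_mean`).

The rest is the central limit theorem for `(S 0, S 1, S 2)`. The summands have disjoint supports
and, by rotation, equal means `γ` and second moments `σ²`, so the limit has covariance `σ² δ_lm -
γ²`, with `δ_lm` the Kronecker symbol. This is the covariance of `Z l - (Z 0 + Z 1 + Z 2) / 3 + G`,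
whose mean over `l` is `G`. Taking the mean, the maximum, and their difference gives the three
limits (`tendstoInDistribution_of_isLittleO`). Bounded second moments carry the convergence over to
the means. -/

open scoped Topology

namespace PlanarLoad

/-! ### Convergence in distribution: Cramér–Wold and convergence of means -/

section Convergence

/-- Both sides integrate `exp (i ⟨V, t⟩)`. This reduces Lévy's continuity theorem in `E` to real
projections evaluated at `1`. -/
lemma charFun_map_eq_charFun_map_inner {Ω E : Type*} [MeasurableSpace Ω] [NormedAddCommGroup E]
    [InnerProductSpace ℝ E] [FiniteDimensional ℝ E] [MeasurableSpace E] [BorelSpace E]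
    {P : Measure Ω} {V : Ω → E} (hV : AEMeasurable V P) (t : E) :
    charFun (P.map V) t = charFun (P.map fun ω => inner ℝ (V ω) t) 1 := by
  rw [charFun_apply, charFun_apply, integral_map hV (by fun_prop),
    integral_map (by fun_prop) (by fun_prop)]
  simp

variable {Ω Ω' : Type*} [MeasurableSpace Ω] [MeasurableSpace Ω']
  {P : Measure Ω} [IsProbabilityMeasure P] {P' : Measure Ω'} [IsProbabilityMeasure P']

/-- The **Cramér–Wold device** in a finite-dimensional inner product space. -/
theorem tendstoInDistribution_of_forall_inner {E : Type*} [NormedAddCommGroup E]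
    [InnerProductSpace ℝ E] [FiniteDimensional ℝ E] [MeasurableSpace E] [BorelSpace E]
    {V : ℕ → Ω → E} {W : Ω' → E} (hV : ∀ n, AEMeasurable (V n) P) (hW : AEMeasurable W P')
    (h : ∀ t : E, TendstoInDistribution (fun n ω => inner ℝ (V n ω) t) atTop
      (fun ω => inner ℝ (W ω) t) (fun _ => P) P') :
    TendstoInDistribution V atTop W (fun _ => P) P' where
  forall_aemeasurable := hV
  aemeasurable_limit := hW
  tendsto := by
    refine ProbabilityMeasure.tendsto_iff_tendsto_charFun.2 fun t => ?_
    have h1 := ProbabilityMeasure.tendsto_iff_tendsto_charFun.1 (h t).tendsto 1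
    simp only [ProbabilityMeasure.coe_mk] at h1 ⊢
    rw [charFun_map_eq_charFun_map_inner hW]
    exact h1.congr fun n => (charFun_map_eq_charFun_map_inner (hV n) t).symm

/-- The difference vanishes for `|x| ≤ M` and is otherwise at most `|x|`, which is then at most `x ^
2 / M`. So second moments control the truncation error uniformly. -/
lemma abs_sub_clamp_le {M : ℝ} (hM : 0 < M) (x : ℝ) : |x - max (-M) (min x M)| ≤ x ^ 2 / M := by
  rw [le_div_iff₀ hM]
  rcases le_total x M with h | h
  · rw [min_eq_left h]
    rcases le_total (-M) x with h' | h'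
    · rw [max_eq_right h']; simp; positivity
    · rw [max_eq_left h', abs_of_nonpos (by linarith)]; nlinarith
  · rw [min_eq_right h, max_eq_right (by linarith), abs_of_nonneg (by linarith)]; nlinarith

lemma abs_integral_sub_integral_clamp_le {Ω : Type*} [MeasurableSpace Ω] {P : Measure Ω}
    [IsProbabilityMeasure P] {Y : Ω → ℝ} (hY : MemLp Y 2 P) {M : ℝ} (hM : 0 < M) :
    |∫ ω, Y ω ∂P - ∫ ω, max (-M) (min (Y ω) M) ∂P| ≤ (∫ ω, Y ω ^ 2 ∂P) / M := by
  have hYm := hY.aestronglyMeasurable.aemeasurable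
  have hint : Integrable (fun ω => max (-M) (min (Y ω) M)) P := by
    refine Integrable.of_bound (C := M)
      (AEMeasurable.aestronglyMeasurable (by fun_prop)) (ae_of_all _ fun ω => ?_)
    rw [Real.norm_eq_abs, abs_le]
    exact ⟨le_max_left _ _, max_le (by linarith) (min_le_right _ _)⟩
  rw [← integral_sub (hY.integrable (by simp)) hint, ← integral_div]
  exact abs_integral_le_integral_abs.trans (integral_mono_of_nonneg
    (ae_of_all _ fun _ => abs_nonneg _) (hY.integrable_sq.div_const _)
    (ae_of_all _ fun ω => abs_sub_clamp_le hM _))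

/-- Convergence in distribution together with a uniform bound on the second moments implies
convergence of the means. -/
theorem tendsto_integral_of_tendstoInDistribution {X : ℕ → Ω → ℝ} {Z : Ω' → ℝ} {C : ℝ}
    (hX : TendstoInDistribution X atTop Z (fun _ => P) P')
    (hX2 : ∀ n, MemLp (X n) 2 P) (hC : ∀ n, ∫ ω, X n ω ^ 2 ∂P ≤ C) (hZ : MemLp Z 2 P') :
    Tendsto (fun n => ∫ ω, X n ω ∂P) atTop (𝓝 (∫ ω, Z ω ∂P')) := by
  set K := max C (∫ ω, Z ω ^ 2 ∂P') with hK
  have hK0 : 0 ≤ K := le_max_of_le_right (integral_nonneg fun ω => sq_nonneg _)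
  rw [Metric.tendsto_atTop]
  intro ε hε
  -- Truncation at this level changes each mean, and that of the limit, by at most `K / M < ε / 3`;
  -- weak convergence of the truncated variables supplies the last third. The `+ 1` keeps `M`
  -- positive when `K = 0`.
  set M := 3 * (K + 1) / ε with hMdef
  have hM : 0 < M := by positivity
  have hKM : K / M < ε / 3 := by
    rw [hMdef, div_div_eq_mul_div, div_lt_iff₀ (by positivity)]; nlinarith
  let g : BoundedContinuousFunction ℝ ℝ := BoundedContinuousFunction.ofNormedAddCommGroup
    (fun x => max (-M) (min x M)) (by fun_prop) M fun x => by
      rw [Real.norm_eq_abs, abs_le]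
      exact ⟨le_max_left _ _, max_le (by linarith) (min_le_right _ _)⟩
  have hg := ProbabilityMeasure.tendsto_iff_forall_integral_tendsto.1 hX.tendsto g
  simp only [ProbabilityMeasure.coe_mk] at hg
  rw [integral_map hX.aemeasurable_limit (by fun_prop)] at hg
  obtain ⟨N, hN⟩ := Metric.tendsto_atTop.1 hg (ε / 3) (by positivity)
  refine ⟨N, fun n hn => ?_⟩
  have h1 := hN n hn
  rw [integral_map (hX.forall_aemeasurable n) (by fun_prop), Real.dist_eq] at h1
  have h2 := abs_integral_sub_integral_clamp_le (hX2 n) hM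
  have h3 := abs_integral_sub_integral_clamp_le hZ hM
  have h4 : (∫ ω, X n ω ^ 2 ∂P) / M ≤ K / M := by gcongr; exact (hC n).trans (le_max_left _ _)
  have h5 : (∫ ω, Z ω ^ 2 ∂P') / M ≤ K / M := by gcongr; exact le_max_right _ _
  simp only [g, BoundedContinuousFunction.coe_ofNormedAddCommGroup] at h1
  rw [Real.dist_eq]
  rw [abs_lt] at h1 ⊢
  rw [abs_le] at h2 h3
  constructor <;> linarith [h1.1, h1.2, h2.1, h2.2, h3.1, h3.2]

end Convergence

/-! ### Linear combinations of independent Gaussian variables -/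

section Gaussian

variable {Ω : Type*} [MeasurableSpace Ω] {P : Measure Ω} [IsProbabilityMeasure P]

/-- A linear combination of independent centred Gaussian variables is Gaussian. -/
lemma hasLaw_sum_mul_add_mul {ι : Type*} [Fintype ι] {Z : ι → Ω → ℝ} {G : Ω → ℝ} {s v : ℝ}
    (hs : 0 ≤ s) (hv : 0 ≤ v) (hG : HasLaw G (gaussianReal 0 v.toNNReal) P)
    (hZ : ∀ i, HasLaw (Z i) (gaussianReal 0 s.toNNReal) P) (hZi : iIndepFun Z P)
    (hGZ : IndepFun G (fun ω i => Z i ω) P) (a : ι → ℝ) (b : ℝ) :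
    HasLaw (fun ω => ∑ i, a i * Z i ω + b * G ω)
      (gaussianReal 0 (s * ∑ i, a i ^ 2 + v * b ^ 2).toNNReal) P where
  aemeasurable := by
    have := fun i => (hZ i).aemeasurable
    have := hG.aemeasurable
    fun_prop
  map_eq := by
    have hZm := fun i => (hZ i).aemeasurable
    have hGm := hG.aemeasurable
    have hind : IndepFun (fun ω => ∑ i, a i * Z i ω) (fun ω => b * G ω) P :=
      (hGZ.symm.comp (φ := fun z : ι → ℝ => ∑ i, a i * z i) (ψ := fun g => b * g)
        (by fun_prop) (by fun_prop))
    have hiind : iIndepFun (fun i ω => a i * Z i ω) P :=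
      hZi.comp (fun i z => a i * z) (by fun_prop)
    have : IsProbabilityMeasure (P.map fun ω => ∑ i, a i * Z i ω + b * G ω) :=
      Measure.isProbabilityMeasure_map (by fun_prop)
    refine Measure.ext_of_charFun ?_
    ext t
    rw [hind.charFun_map_fun_add_eq_mul (by fun_prop) (by fun_prop),
      hiind.charFun_map_fun_sum_eq_prod (by fun_prop), Pi.mul_apply, Finset.prod_apply,
      charFun_map_mul_comp hGm, hG.map_eq]
    simp_rw [charFun_map_mul_comp (hZm _), (hZ _).map_eq, charFun_gaussianReal]
    rw [← Complex.exp_sum, ← Complex.exp_add, Real.coe_toNNReal _ hs, Real.coe_toNNReal _ hv,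
      Real.coe_toNNReal _ (add_nonneg (mul_nonneg hs (Finset.sum_nonneg fun i _ => sq_nonneg _))
        (mul_nonneg hv (sq_nonneg _)))]
    congr 1
    push_cast
    simp only [mul_zero, zero_mul, zero_sub]
    rw [Finset.sum_neg_distrib, Finset.mul_sum, add_mul, Finset.sum_mul, add_div, Finset.sum_div,
      neg_add]
    congr 2
    · exact Finset.sum_congr rfl fun i _ => by ring
    · ring

end Gaussian

/-! ### Second moments of sums of i.i.d. variables -/

section IID

variable {Ω α : Type*} [MeasurableSpace Ω] [MeasurableSpace α]
  {P : Measure Ω} [IsProbabilityMeasure P] {ν : Measure α}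
  {X : ℕ → Ω → α}

omit [IsProbabilityMeasure P] in
lemma memLp_sum_comp (hX : ∀ k, HasLaw (X k) ν P) {f : α → ℝ} (hf : MemLp f 2 ν) (n : ℕ) :
    MemLp (fun ω => ∑ k ∈ Finset.range n, f (X k ω)) 2 P :=
  memLp_finsetSum _ fun k _ => by
    have := hf
    rw [← (hX k).map_eq] at this
    exact (memLp_map_measure_iff this.1 (hX k).aemeasurable).1 this

/-- The second moment of a centred sum of independent identically distributed variables. -/
lemma integral_sq_sum_comp_sub (hX : ∀ k, HasLaw (X k) ν P) (hXi : iIndepFun X P)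
    {f : α → ℝ} (hfm : Measurable f) (hf : MemLp f 2 ν) (n : ℕ) :
    ∫ ω, (∑ k ∈ Finset.range n, f (X k ω) - n * ∫ x, f x ∂ν) ^ 2 ∂P = n * Var[f; ν] := by
  have hmem : ∀ k, MemLp (fun ω => f (X k ω)) 2 P := fun k => by
    have := hf
    rw [← (hX k).map_eq] at this
    exact (memLp_map_measure_iff this.1 (hX k).aemeasurable).1 this
  have hmean : ∀ k, ∫ ω, f (X k ω) ∂P = ∫ x, f x ∂ν := fun k => by
    rw [← (hX k).map_eq, integral_map (hX k).aemeasurable hfm.aestronglyMeasurable]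
  have hvar : ∀ k, Var[fun ω => f (X k ω); P] = Var[f; ν] := fun k => by
    rw [← (hX k).map_eq, variance_map hfm.aemeasurable (hX k).aemeasurable]; rfl
  have hsum := IndepFun.variance_sum (X := fun k ω => f (X k ω)) (s := Finset.range n) (μ := P)
    (fun k _ => hmem k) fun i _ j _ hij => (hXi.indepFun hij).comp hfm hfm
  have hE : ∫ ω, (∑ k ∈ Finset.range n, fun ω => f (X k ω)) ω ∂P = n * ∫ x, f x ∂ν := by
    simp only [Finset.sum_apply]
    rw [integral_finsetSum _ fun k _ => (hmem k).integrable (by simp)]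
    simp [hmean]
  rw [variance_eq_integral, hE] at hsum
  · simpa [hvar] using hsum
  · exact (memLp_finsetSum' _ fun k _ => hmem k).1.aemeasurable

end IID

/-! ### Central limit theorem for the three cell loads -/

section Limits

variable {Ω Ω' α : Type*} [MeasurableSpace Ω] [MeasurableSpace Ω'] [MeasurableSpace α]
  {P : Measure Ω} [IsProbabilityMeasure P] {P' : Measure Ω'} [IsProbabilityMeasure P']
  {ν : Measure α} [IsProbabilityMeasure ν] {X : ℕ → Ω → α}
  {f : Fin 3 → α → ℝ} {γ s : ℝ}

lemma integral_sum_mul (hf : ∀ l, MemLp (f l) 2 ν) (hγ : ∀ l, ∫ x, f l x ∂ν = γ)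
    (t : Fin 3 → ℝ) : ∫ x, ∑ l, t l * f l x ∂ν = γ * ∑ l, t l := by
  rw [integral_finsetSum _ fun l _ => ((hf l).integrable (by simp)).const_mul _]
  simp_rw [integral_const_mul, hγ, Finset.mul_sum]
  exact Finset.sum_congr rfl fun l _ => mul_comm _ _

omit [IsProbabilityMeasure ν] in
lemma memLp_sum_mul (hf : ∀ l, MemLp (f l) 2 ν) (t : Fin 3 → ℝ) :
    MemLp (fun x => ∑ l, t l * f l x) 2 ν :=
  memLp_finsetSum _ fun l _ => (hf l).const_mul _

/-- The variance of a linear combination of functions with disjoint supports, equal means and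
equal second moments. -/
lemma variance_sum_mul (hf : ∀ l, MemLp (f l) 2 ν) (hγ : ∀ l, ∫ x, f l x ∂ν = γ)
    (hs : ∀ l, ∫ x, f l x ^ 2 ∂ν = s) (horth : ∀ l m, l ≠ m → ∀ x, f l x * f m x = 0)
    (t : Fin 3 → ℝ) :
    Var[fun x => ∑ l, t l * f l x; ν] = s * ∑ l, t l ^ 2 - γ ^ 2 * (∑ l, t l) ^ 2 := by
  rw [variance_eq_sub (memLp_sum_mul hf t), integral_sum_mul hf hγ]
  have : ∀ x, ((fun x => ∑ l, t l * f l x) ^ 2) x = ∑ l, t l ^ 2 * f l x ^ 2 := fun x => by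
    have h01 := horth 0 1 (by decide) x
    have h02 := horth 0 2 (by decide) x
    have h12 := horth 1 2 (by decide) x
    simp only [Pi.pow_apply, Fin.sum_univ_three]
    linear_combination 2 * t 0 * t 1 * h01 + 2 * t 0 * t 2 * h02 + 2 * t 1 * t 2 * h12
  simp_rw [this]
  rw [integral_finsetSum _ fun l _ => (hf l).integrable_sq.const_mul _]
  simp_rw [integral_const_mul, hs, ← Finset.sum_mul]
  ring

/-- The variance of `f 0 + f 1 + f 2` is `3 s - 9 γ ^ 2`, nine times this quantity. -/
lemma sub_sq_nonneg_of_orthogonal (hf : ∀ l, MemLp (f l) 2 ν) (hγ : ∀ l, ∫ x, f l x ∂ν = γ)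
    (hs : ∀ l, ∫ x, f l x ^ 2 ∂ν = s) (horth : ∀ l m, l ≠ m → ∀ x, f l x * f m x = 0) :
    0 ≤ s / 3 - γ ^ 2 := by
  have h := variance_sum_mul hf hγ hs horth fun _ => 1
  have := variance_nonneg (fun x => ∑ l, 1 * f l x) ν
  simp only [Fin.sum_univ_three] at h this
  nlinarith

/-- The **central limit theorem** for the vector of the sums of three functions with disjoint
supports, equal means and equal second moments. -/
theorem tendstoInDistribution_toLp_sum (hX : ∀ k, HasLaw (X k) ν P) (hXi : iIndepFun X P)
    (hfm : ∀ l, Measurable (f l))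
    (hf : ∀ l, MemLp (f l) 2 ν) (hγ : ∀ l, ∫ x, f l x ∂ν = γ)
    (hs : ∀ l, ∫ x, f l x ^ 2 ∂ν = s) (horth : ∀ l m, l ≠ m → ∀ x, f l x * f m x = 0)
    {G : Ω' → ℝ} {Z : Fin 3 → Ω' → ℝ} (hG : HasLaw G (gaussianReal 0 (s / 3 - γ ^ 2).toNNReal) P')
    (hZ : ∀ i, HasLaw (Z i) (gaussianReal 0 s.toNNReal) P') (hZi : iIndepFun Z P')
    (hGZ : IndepFun G (fun ω i => Z i ω) P') :
    TendstoInDistribution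
      (fun (n : ℕ) ω => WithLp.toLp 2 fun l : Fin 3 =>
        (√(n : ℝ))⁻¹ * (∑ k ∈ Finset.range n, f l (X k ω) - n * γ)) atTop
      (fun ω => WithLp.toLp 2 fun l : Fin 3 => Z l ω - (Z 0 ω + Z 1 ω + Z 2 ω) / 3 + G ω)
      (fun _ => P) P' := by
  have hXm := fun k => (hX k).aemeasurable
  have hZm := fun i => (hZ i).aemeasurable
  have hGm := hG.aemeasurable
  have hs0 : 0 ≤ s := hs 0 ▸ integral_nonneg fun x => sq_nonneg _
  refine tendstoInDistribution_of_forall_inner (fun n => ?_) ?_ fun t => ?_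
  · have : ∀ l k, AEMeasurable (fun ω => f l (X k ω)) P := fun l k =>
      (hfm l).comp_aemeasurable (hXm k)
    fun_prop
  · fun_prop
  set g : α → ℝ := fun x => ∑ l, t l * f l x with hg
  have hgm : Measurable g := by fun_prop
  have hgL : MemLp g 2 ν := memLp_sum_mul hf t
  have hgX : ∀ k, AEMeasurable (fun ω => g (X k ω)) P := fun k => hgm.comp_aemeasurable (hXm k)
  have hmap : ∀ k, P.map (fun ω => g (X k ω)) = ν.map g := fun k => by
    rw [← (hX k).map_eq, AEMeasurable.map_map_of_aemeasurable (by fun_prop) (hXm k)]; rfl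
  have hvar : Var[fun ω => g (X 0 ω); P] = s * ∑ l, t l ^ 2 - γ ^ 2 * (∑ l, t l) ^ 2 := by
    rw [← variance_sum_mul hf hγ hs horth, ← (hX 0).map_eq,
      variance_map hgm.aemeasurable (hXm 0)]
    rfl
  have hmean : ∫ ω, g (X 0 ω) ∂P = γ * ∑ l, t l := by
    rw [← integral_sum_mul hf hγ, ← (hX 0).map_eq,
      integral_map (hXm 0) hgm.aestronglyMeasurable]
  -- The projection of the limit on `t` is regrouped by independent variables: `Z l` has coefficient
  -- `t l - (∑ t) / 3` and `G` has coefficient `∑ t`. The variance `s (∑ t² - (∑ t)² / 3) + (s / 3 -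
  -- γ²) (∑ t)²` collapses to that of the summands `∑ t l * f l`.
  have hlaw := hasLaw_sum_mul_add_mul hs0 (sub_sq_nonneg_of_orthogonal hf hγ hs horth) hG hZ hZi hGZ
    (fun l => t l - (∑ m, t m) / 3) (∑ m, t m)
  have hY : HasLaw (fun ω => ∑ l, (t l - (∑ m, t m) / 3) * Z l ω + (∑ m, t m) * G ω)
      (gaussianReal 0 Var[fun ω => g (X 0 ω); P].toNNReal) P' := by
    convert hlaw using 3
    rw [hvar]
    simp only [Fin.sum_univ_three]
    ring
  have hclt := tendstoInDistribution_inv_sqrt_mul_sum_sub hY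
    (X := fun k ω => g (X k ω)) ?_ (hXi.comp (fun _ => g) fun _ => hgm)
    (fun k => ⟨hgX k, hgX 0, by rw [hmap, hmap]⟩)
  · rw [hmean] at hclt
    convert! hclt using 2 with n n
    · ext ω
      simp only [PiLp.inner_apply, hg, Fin.sum_univ_three, RCLike.inner_apply, conj_trivial,
        Finset.sum_add_distrib, ← Finset.mul_sum]
      ring
    · simp only [PiLp.inner_apply, Fin.sum_univ_three, RCLike.inner_apply, conj_trivial]
      ring
  · have := hgL
    rw [← (hX 0).map_eq] at this
    exact (memLp_map_measure_iff this.1 (hXm 0)).1 this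

end Limits

/-! ### The maximum of three Gaussian variables -/

section GaussianMax

variable {Ω : Type*} [MeasurableSpace Ω] {P : Measure Ω} [IsProbabilityMeasure P]

omit [IsProbabilityMeasure P] in
lemma memLp_two_of_hasLaw_gaussianReal {Y : Ω → ℝ} {v : NNReal}
    (hY : HasLaw Y (gaussianReal 0 v) P) : MemLp Y 2 P := by
  have h := memLp_id_gaussianReal' (μ := 0) (v := v) 2 (by simp)
  rw [← hY.map_eq] at h
  exact (memLp_map_measure_iff h.1 hY.aemeasurable).1 h

omit [IsProbabilityMeasure P] in
lemma integral_eq_zero_of_hasLaw_gaussianReal {Y : Ω → ℝ} {v : NNReal}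
    (hY : HasLaw Y (gaussianReal 0 v) P) : ∫ ω, Y ω ∂P = 0 := by
  have h := integral_id_gaussianReal (μ := 0) (v := v)
  rwa [← hY.map_eq, integral_map hY.aemeasurable (by fun_prop)] at h

omit [IsProbabilityMeasure P] in
lemma memLp_max_three {Y : Fin 3 → Ω → ℝ} (hY : ∀ i, MemLp (Y i) 2 P) :
    MemLp (fun ω => max (max (Y 0 ω) (Y 1 ω)) (Y 2 ω)) 2 P :=
  ((hY 0).sup (hY 1)).sup (hY 2)

/-- The mean of the maximum of three independent centred Gaussian variables of variance `s`. -/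
lemma integral_max_three_eq {Z : Fin 3 → Ω → ℝ} {s : ℝ} (hs : 0 ≤ s)
    (hZ : ∀ i, HasLaw (Z i) (gaussianReal 0 s.toNNReal) P) (hZi : iIndepFun Z P) :
    ∫ ω, max (max (Z 0 ω) (Z 1 ω)) (Z 2 ω) ∂P = stdNormalMaxMean * √s := by
  have hZm := fun i => (hZ i).aemeasurable
  have h1 : P.map (fun ω i => Z i ω) = Measure.pi fun _ => gaussianReal 0 s.toNNReal := by
    rw [(iIndepFun_iff_map_fun_eq_pi_map hZm).1 hZi]
    simp_rw [(hZ _).map_eq]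
  have h2 : (Measure.pi fun _ : Fin 3 => gaussianReal 0 1).map (fun g i => √s * g i) =
      Measure.pi fun _ : Fin 3 => gaussianReal 0 s.toNNReal := by
    have hm : (gaussianReal 0 1).map (fun x => √s * x) = gaussianReal 0 s.toNNReal := by
      rw [gaussianReal_map_const_mul]
      congr 1
      · simp
      · ext; simp [Real.sq_sqrt hs, hs]
    have := Measure.pi_map_pi (μ := fun _ : Fin 3 => gaussianReal 0 1)
      (f := fun _ x => √s * x) (fun i => by fun_prop)
    rw [this]
    simp_rw [hm]
  have h3 : ∫ ω, max (max (Z 0 ω) (Z 1 ω)) (Z 2 ω) ∂P =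
      ∫ z : Fin 3 → ℝ, max (max (z 0) (z 1)) (z 2) ∂(P.map fun ω i => Z i ω) := by
    rw [integral_map (by fun_prop)]
    exact Measurable.aestronglyMeasurable (by fun_prop)
  rw [h3, h1, ← h2, integral_map (Measurable.aemeasurable (by fun_prop))
      (Measurable.aestronglyMeasurable (by fun_prop)),
    stdNormalMaxMean, ← integral_mul_const]
  congr with g
  rw [← mul_max_of_nonneg _ _ (Real.sqrt_nonneg s), ← mul_max_of_nonneg _ _ (Real.sqrt_nonneg s),
    mul_comm]

/-- The maximum of three independent nondegenerate centred Gaussian variables has positive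
mean. -/
lemma integral_max_three_pos {Z : Fin 3 → Ω → ℝ} {v : NNReal} (hv : v ≠ 0)
    (hZ : ∀ i, HasLaw (Z i) (gaussianReal 0 v) P) (hZi : iIndepFun Z P) :
    0 < ∫ ω, max (max (Z 0 ω) (Z 1 ω)) (Z 2 ω) ∂P := by
  have hL := fun i => memLp_two_of_hasLaw_gaussianReal (hZ i)
  have hint := fun i => (hL i).integrable (q := 2) (by simp)
  have h0 := fun i => integral_eq_zero_of_hasLaw_gaussianReal (hZ i)
  have hmax := (memLp_max_three hL).integrable (q := 2) (by simp)
  have hnn : 0 ≤ fun ω => max (max (Z 0 ω) (Z 1 ω)) (Z 2 ω) - Z 0 ω := fun ω => by simp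
  have hE : ∫ ω, (max (max (Z 0 ω) (Z 1 ω)) (Z 2 ω) - Z 0 ω) ∂P =
      ∫ ω, max (max (Z 0 ω) (Z 1 ω)) (Z 2 ω) ∂P := by
    rw [integral_sub hmax (hint 0), h0, sub_zero]
  rw [← hE]
  -- If the mean were zero, the maximum would equal `Z 0` almost surely, so `Z 0 ≥ Z 1`; equal means
  -- then force `Z 0 = Z 1` almost surely, contradicting the variance `2 v` of their difference.
  refine lt_of_le_of_ne (integral_nonneg hnn) fun heq => ?_
  have hae := (integral_eq_zero_iff_of_nonneg hnn (hmax.sub (hint 0))).1 heq.symm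
  have hle : ∀ᵐ ω ∂P, 0 ≤ Z 0 ω - Z 1 ω := by
    filter_upwards [hae] with ω hω
    have : Z 1 ω ≤ max (max (Z 0 ω) (Z 1 ω)) (Z 2 ω) := (le_max_right _ _).trans (le_max_left _ _)
    simp only [Pi.zero_apply] at hω
    linarith
  have hz : ∫ ω, (Z 0 ω - Z 1 ω) ∂P = 0 := by rw [integral_sub (hint 0) (hint 1), h0, h0, sub_zero]
  have hae2 := (integral_eq_zero_iff_of_nonneg_ae hle ((hint 0).sub (hint 1))).1 hz
  have hvar : Var[fun ω => Z 0 ω - Z 1 ω; P] = 0 := by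
    rw [variance_congr hae2]; exact variance_zero _
  rw [variance_fun_sub (hL 0) (hL 1), (hZi.indepFun (by decide)).covariance_eq_zero (hL 0) (hL 1),
    (hZ 0).variance_eq, (hZ 1).variance_eq, variance_id_gaussianReal] at hvar
  exact hv (NNReal.coe_eq_zero.1 (by linarith))

end GaussianMax

/-! ### From the CLT to the limits of the two loads -/

section LimitTheorem

variable {Ω Ω' α : Type*} [MeasurableSpace Ω] [MeasurableSpace Ω'] [MeasurableSpace α]
  {P : Measure Ω} [IsProbabilityMeasure P] {P' : Measure Ω'} [IsProbabilityMeasure P']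
  {ν : Measure α} [IsProbabilityMeasure ν] {X : ℕ → Ω → α}
  {f : Fin 3 → α → ℝ} {γ s : ℝ}

lemma sq_max_three_le (a b c : ℝ) : max (max a b) c ^ 2 ≤ a ^ 2 + b ^ 2 + c ^ 2 := by
  rcases max_cases a b with h | h <;> rcases max_cases (max a b) c with h' | h' <;>
    rw [h'.1] <;> (try rw [h.1]) <;> nlinarith [sq_nonneg a, sq_nonneg b, sq_nonneg c]

omit [IsProbabilityMeasure P] in
-- For nonnegative `D n` the mean is the `L¹` norm, and `L¹` convergence implies convergence in
-- measure. This makes the gap negligible in Slutsky's theorem.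
lemma tendstoInMeasure_of_isLittleO_integral {D : ℕ → Ω → ℝ} (hD : ∀ n, Integrable (D n) P)
    (h0 : ∀ n, 0 ≤ᵐ[P] D n) (hE : (fun n => ∫ ω, D n ω ∂P) =o[atTop] fun n : ℕ => √(n : ℝ)) :
    TendstoInMeasure P (fun (n : ℕ) ω => (√(n : ℝ))⁻¹ * D n ω) atTop (fun _ => (0 : ℝ)) := by
  refine tendstoInMeasure_of_tendsto_eLpNorm (p := 1) one_ne_zero
    (fun n => ((hD n).const_mul _).1) aestronglyMeasurable_const ?_
  have h1 : ∀ n : ℕ, eLpNorm ((fun ω => (√(n : ℝ))⁻¹ * D n ω) - fun _ => (0 : ℝ)) 1 P =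
      ENNReal.ofReal ((∫ ω, D n ω ∂P) / √(n : ℝ)) := fun n => by
    rw [eLpNorm_one_eq_lintegral_enorm, ← ofReal_integral_norm_eq_lintegral_enorm]
    · congr 1
      rw [div_eq_inv_mul, ← integral_const_mul]
      refine integral_congr_ae ?_
      filter_upwards [h0 n] with ω hω
      simp only [Pi.zero_apply] at hω
      simp only [Pi.sub_apply, sub_zero, Real.norm_eq_abs]
      exact abs_of_nonneg (by positivity)
    · exact ((hD n).const_mul (√(n : ℝ))⁻¹).sub (integrable_zero _ _ _)
  simp_rw [h1]
  simpa using ENNReal.tendsto_ofReal hE.tendsto_div_nhds_zero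

omit [IsProbabilityMeasure P] in
lemma integral_mean_three {Y : Fin 3 → Ω → ℝ} (hY : ∀ i, Integrable (Y i) P) :
    ∫ ω, (Y 0 ω + Y 1 ω + Y 2 ω) / 3 ∂P =
      (∫ ω, Y 0 ω ∂P + ∫ ω, Y 1 ω ∂P + ∫ ω, Y 2 ω ∂P) / 3 := by
  rw [integral_div, integral_add (f := fun ω => Y 0 ω + Y 1 ω) ((hY 0).add (hY 1)) (hY 2),
    integral_add (hY 0) (hY 1)]

omit [IsProbabilityMeasure P'] in
lemma integral_max_sub_mean_add {G : Ω' → ℝ} {Z : Fin 3 → Ω' → ℝ} (hG : Integrable G P')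
    (hZ : ∀ i, MemLp (Z i) 2 P') [IsFiniteMeasure P'] (hG0 : ∫ ω, G ω ∂P' = 0)
    (hZ0 : ∀ i, ∫ ω, Z i ω ∂P' = 0) :
    ∫ ω, (max (max (Z 0 ω) (Z 1 ω)) (Z 2 ω) - (Z 0 ω + Z 1 ω + Z 2 ω) / 3 + G ω) ∂P' =
      ∫ ω, max (max (Z 0 ω) (Z 1 ω)) (Z 2 ω) ∂P' := by
  have hint := fun i => (hZ i).integrable (q := 2) (by simp)
  have hmax := (memLp_max_three hZ).integrable (q := 2) (by simp)
  have hmean : Integrable (fun ω => (Z 0 ω + Z 1 ω + Z 2 ω) / 3) P' :=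
    (((hint 0).add (hint 1)).add (hint 2)).div_const 3
  rw [integral_add (f := fun ω => max (max (Z 0 ω) (Z 1 ω)) (Z 2 ω) -
      (Z 0 ω + Z 1 ω + Z 2 ω) / 3) (hmax.sub hmean) hG, integral_sub hmax hmean,
    integral_mean_three hint, hG0, hZ0, hZ0, hZ0]
  simp

/-- The limit theorem for the maximum `ρbar` of three sums with disjoint summands, and for a
quantity `ρ` that exceeds the mean of these sums by `o(√n)` on average. -/
theorem tendstoInDistribution_of_isLittleO
    (hX : ∀ k, HasLaw (X k) ν P) (hXi : iIndepFun X P)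
    (hfm : ∀ l, Measurable (f l))
    (hf : ∀ l, MemLp (f l) 2 ν) (hγ : ∀ l, ∫ x, f l x ∂ν = γ)
    (hs : ∀ l, ∫ x, f l x ^ 2 ∂ν = s) (horth : ∀ l m, l ≠ m → ∀ x, f l x * f m x = 0)
    {G : Ω' → ℝ} {Z : Fin 3 → Ω' → ℝ} (hG : HasLaw G (gaussianReal 0 (s / 3 - γ ^ 2).toNNReal) P')
    (hZ : ∀ i, HasLaw (Z i) (gaussianReal 0 s.toNNReal) P') (hZi : iIndepFun Z P')
    (hGZ : IndepFun G (fun ω i => Z i ω) P') {ρ ρbar : ℕ → Ω → ℝ} {S : Fin 3 → ℕ → Ω → ℝ}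
    (hS : ∀ l n ω, S l n ω = ∑ k ∈ Finset.range n, f l (X k ω))
    (hbar : ∀ n, ρbar n =ᵐ[P] fun ω => max (max (S 0 n ω) (S 1 n ω)) (S 2 n ω))
    (hρ : ∀ n, Integrable (ρ n) P)
    (hlow : ∀ n, ∀ᵐ ω ∂P, (S 0 n ω + S 1 n ω + S 2 n ω) / 3 ≤ ρ n ω)
    (hE : (fun n => ∫ ω, (ρ n ω - (S 0 n ω + S 1 n ω + S 2 n ω) / 3) ∂P) =o[atTop]
      fun n : ℕ => √(n : ℝ)) :
    TendstoInDistribution (fun (n : ℕ) ω => (√(n : ℝ))⁻¹ * (ρ n ω - γ * n)) atTop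
      G (fun _ => P) P' ∧
    TendstoInDistribution (fun (n : ℕ) ω => (√(n : ℝ))⁻¹ * (ρbar n ω - γ * n)) atTop
      (fun ω => max (max (Z 0 ω) (Z 1 ω)) (Z 2 ω) - (Z 0 ω + Z 1 ω + Z 2 ω) / 3 + G ω)
      (fun _ => P) P' ∧
    TendstoInDistribution (fun (n : ℕ) ω => (√(n : ℝ))⁻¹ * (ρbar n ω - ρ n ω)) atTop
      (fun ω => max (max (Z 0 ω) (Z 1 ω)) (Z 2 ω) - (Z 0 ω + Z 1 ω + Z 2 ω) / 3)
      (fun _ => P) P' ∧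
    (∀ n, Integrable (ρbar n) P) ∧
    (fun n : ℕ => (∫ ω, ρ n ω ∂P) - n * γ) =o[atTop] (fun n : ℕ => √(n : ℝ)) ∧
    (fun n : ℕ => (∫ ω, ρbar n ω ∂P) -
        (n * γ + (∫ ω, max (max (Z 0 ω) (Z 1 ω)) (Z 2 ω) ∂P') * √(n : ℝ))) =o[atTop]
      (fun n : ℕ => √(n : ℝ)) := by
  have hclt := tendstoInDistribution_toLp_sum hX hXi hfm hf hγ hs horth hG hZ hZi hGZ
  simp_rw [← hS] at hclt
  have hSL : ∀ l n, MemLp (S l n) 2 P := fun l n => by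
    simpa only [← hS] using memLp_sum_comp hX (hf l) n
  have hSint := fun l n => (hSL l n).integrable (q := 2) (by simp)
  have hmeanint : ∀ n, Integrable (fun ω => (S 0 n ω + S 1 n ω + S 2 n ω) / 3) P := fun n =>
    (((hSint 0 n).add (hSint 1 n)).add (hSint 2 n)).div_const 3
  have hSmax : ∀ n, MemLp (fun ω => max (max (S 0 n ω) (S 1 n ω)) (S 2 n ω)) 2 P := fun n =>
    memLp_max_three fun l => hSL l n
  have hSE : ∀ l n, ∫ ω, S l n ω ∂P = n * γ := fun l n => by
    simp_rw [hS]
    rw [integral_finsetSum _ fun k _ => ?_]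
    · have : ∀ k, ∫ ω, f l (X k ω) ∂P = γ := fun k => by
        rw [← hγ l, ← (hX k).map_eq,
          integral_map (hX k).aemeasurable (hfm l).aestronglyMeasurable]
      simp [this]
    · have := hf l
      rw [← (hX k).map_eq] at this
      exact ((memLp_map_measure_iff this.1 (hX k).aemeasurable).1 this).integrable (by simp)
  have hDint : ∀ n, Integrable (fun ω => ρ n ω - (S 0 n ω + S 1 n ω + S 2 n ω) / 3) P :=
    fun n => (hρ n).sub (hmeanint n)
  have hDm := tendstoInMeasure_of_isLittleO_integral hDint
    (fun n => by filter_upwards [hlow n] with ω hω; simpa using hω) hE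
  have hDae : ∀ n : ℕ, AEMeasurable
      (fun ω => (√(n : ℝ))⁻¹ * (ρ n ω - (S 0 n ω + S 1 n ω + S 2 n ω) / 3)) P := fun n =>
    ((hDint n).const_mul _).1.aemeasurable
  have hbarmax : TendstoInDistribution (fun (n : ℕ) ω =>
      (√(n : ℝ))⁻¹ * (max (max (S 0 n ω) (S 1 n ω)) (S 2 n ω) - γ * n)) atTop
      (fun ω => max (max (Z 0 ω) (Z 1 ω)) (Z 2 ω) - (Z 0 ω + Z 1 ω + Z 2 ω) / 3 + G ω)
      (fun _ => P) P' := by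
    convert! hclt.continuous_comp
      (g := fun v : EuclideanSpace ℝ (Fin 3) => max (max (v 0) (v 1)) (v 2)) (by fun_prop)
      using 2 with n
    · ext ω
      simp only [Function.comp_apply]
      rw [← mul_max_of_nonneg _ _ (by positivity), ← mul_max_of_nonneg _ _ (by positivity),
        max_sub_sub_right, max_sub_sub_right, mul_comm γ]
    · simp only [Function.comp_apply]
      rw [max_add_add_right, max_sub_sub_right, max_add_add_right, max_sub_sub_right]
  refine ⟨?_, ?_, ?_, ?_, ?_, ?_⟩
  -- The average of the three limit coordinates is `G`, since the centred `Z`-part sums to zero; the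
  -- gap `D` is removed by Slutsky.
  · have h1 := hclt.continuous_comp
      (g := fun v : EuclideanSpace ℝ (Fin 3) => (v 0 + v 1 + v 2) / 3) (by fun_prop)
    convert! h1.add_of_tendstoInMeasure_const hDm hDae using 2 with n n
    · ext ω
      simp only [Function.comp_apply, Pi.add_apply]
      ring
    · simp only [Function.comp_apply]
      ring
  · refine hbarmax.congr (fun n => ?_) .rfl
    filter_upwards [hbar n] with ω hω
    rw [hω]
  -- Maximum minus mean is insensitive to adding a common amount to all coordinates, so `G` drops
  -- out; the third argument is the rescaled gap, tending to `0`.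
  · have h1 := hclt.continuous_comp_prodMk_of_tendstoInMeasure_const
      (g := fun q : EuclideanSpace ℝ (Fin 3) × ℝ =>
        max (max (q.1 0) (q.1 1)) (q.1 2) - (q.1 0 + q.1 1 + q.1 2) / 3 - q.2)
      (by fun_prop) hDm hDae
    refine h1.congr (fun n => ?_) (ae_of_all _ fun ω => ?_)
    · filter_upwards [hbar n] with ω hω
      rw [hω, ← mul_max_of_nonneg _ _ (by positivity), ← mul_max_of_nonneg _ _ (by positivity),
        max_sub_sub_right, max_sub_sub_right]
      ring
    · simp only
      rw [max_add_add_right, max_sub_sub_right, max_add_add_right, max_sub_sub_right]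
      ring
  · exact fun n => ((hSmax n).integrable (by simp)).congr (hbar n).symm
  · refine hE.congr_left fun n => ?_
    rw [integral_sub (hρ n) (hmeanint n),
      integral_mean_three (Y := fun l => S l n) fun l => hSint l n,
      hSE, hSE, hSE]
    ring
  · have hZL := fun i => memLp_two_of_hasLaw_gaussianReal (hZ i)
    have hGL := memLp_two_of_hasLaw_gaussianReal hG
    have hWL : MemLp (fun ω => max (max (Z 0 ω) (Z 1 ω)) (Z 2 ω) -
        (Z 0 ω + Z 1 ω + Z 2 ω) / 3 + G ω) 2 P' := by
      refine ((memLp_max_three hZL).sub ?_).add hGL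
      simpa only [div_eq_inv_mul] using! (((hZL 0).add (hZL 1)).add (hZL 2)).const_mul (3⁻¹ : ℝ)
    have hYL : ∀ n : ℕ, MemLp (fun ω =>
      (√(n : ℝ))⁻¹ * (max (max (S 0 n ω) (S 1 n ω)) (S 2 n ω) - γ * n)) 2 P := fun n =>
      ((hSmax n).sub (memLp_const _)).const_mul _
    have hbound : ∀ n : ℕ, ∫ ω, ((√(n : ℝ))⁻¹ *
        (max (max (S 0 n ω) (S 1 n ω)) (S 2 n ω) - γ * n)) ^ 2 ∂P ≤ ∑ l, Var[f l; ν] := by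
      intro n
      have hvar : ∀ l, ∫ ω, ((√(n : ℝ))⁻¹ * (S l n ω - n * γ)) ^ 2 ∂P ≤ Var[f l; ν] := fun l => by
        simp_rw [mul_pow]
        rw [integral_const_mul]
        have := integral_sq_sum_comp_sub hX hXi (hfm l) (hf l) n
        simp_rw [← hS, hγ] at this
        rw [this, ← mul_assoc, inv_pow, Real.sq_sqrt (by positivity)]
        -- An inequality rather than an equality because at `n = 0` the normalization `(√0)⁻¹` is
        -- `0`.
        exact mul_le_of_le_one_left (variance_nonneg _ _) inv_mul_le_one
      have hint : ∀ l, Integrable (fun ω => ((√(n : ℝ))⁻¹ * (S l n ω - n * γ)) ^ 2) P := fun l =>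
        (((hSL l n).sub (memLp_const _)).const_mul _).integrable_sq
      calc _ ≤ ∫ ω, ∑ l, ((√(n : ℝ))⁻¹ * (S l n ω - n * γ)) ^ 2 ∂P := by
            refine integral_mono (hYL n).integrable_sq (integrable_finsetSum _ fun l _ => hint l)
              fun ω => ?_
            simp only [Fin.sum_univ_three]
            rw [← max_sub_sub_right, ← max_sub_sub_right, mul_max_of_nonneg _ _ (by positivity),
              mul_max_of_nonneg _ _ (by positivity), mul_comm γ]
            exact sq_max_three_le _ _ _
        _ = ∑ l, ∫ ω, ((√(n : ℝ))⁻¹ * (S l n ω - n * γ)) ^ 2 ∂P :=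
            integral_finsetSum _ fun l _ => hint l
        _ ≤ _ := Finset.sum_le_sum fun l _ => hvar l
    have hlim := tendsto_integral_of_tendstoInDistribution hbarmax hYL hbound hWL
    rw [integral_max_sub_mean_add (hGL.integrable (by simp)) hZL
      (integral_eq_zero_of_hasLaw_gaussianReal hG)
      fun i => integral_eq_zero_of_hasLaw_gaussianReal (hZ i)] at hlim
    refine (isLittleO_iff_tendsto' ?_).2 ?_
    · filter_upwards [eventually_gt_atTop 0] with n hn h
      have : 0 < √(n : ℝ) := by positivity
      exact absurd h this.ne'
    · have := hlim.sub_const (∫ ω, max (max (Z 0 ω) (Z 1 ω)) (Z 2 ω) ∂P')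
      rw [sub_self] at this
      refine this.congr' ?_
      filter_upwards [eventually_gt_atTop 0] with n hn
      have hpos : 0 < √(n : ℝ) := by positivity
      rw [integral_const_mul, integral_sub ((hSmax n).integrable (by simp)) (integrable_const _),
        integral_congr_ae (hbar n)]
      simp
      field_simp
      ring

end LimitTheorem

/-! ### Deterministic bounds: least-cost allocations and rebalancing -/

section Allocation

/-- Greedy choice: items are added one at a time until the sum first reaches `b`, and the last item
overshoots by at most `B`. -/
lemma exists_subset_sum_mem_Icc {ι : Type*} (s : Finset ι) {w : ι → ℝ} {B b : ℝ}
    (hw : ∀ i ∈ s, w i ≤ B) (hB : 0 ≤ B) (hb : 0 ≤ b) (hs : b ≤ ∑ i ∈ s, w i) :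
    ∃ t ⊆ s, b ≤ ∑ i ∈ t, w i ∧ ∑ i ∈ t, w i ≤ b + B := by
  classical
  induction s using Finset.induction_on with
  | empty => exact ⟨∅, subset_rfl, hs, by simpa using add_nonneg hb hB⟩
  | insert i s hi ih =>
    rcases le_total b (∑ j ∈ s, w j) with h | h
    · obtain ⟨t, ht, h1, h2⟩ := ih (fun j hj => hw j (Finset.mem_insert_of_mem hj)) h
      exact ⟨t, ht.trans (Finset.subset_insert _ _), h1, h2⟩
    · refine ⟨insert i s, subset_rfl, hs, ?_⟩
      rw [Finset.sum_insert hi]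
      linarith [hw i (Finset.mem_insert_self _ _)]

lemma sup'_univ_three (u : Fin 3 → ℝ) :
    Finset.univ.sup' Finset.univ_nonempty u = max (max (u 0) (u 1)) (u 2) := by
  apply le_antisymm
  · refine Finset.sup'_le _ _ fun l _ => ?_
    fin_cases l <;> simp
  · exact max_le (max_le (Finset.le_sup' u (Finset.mem_univ _))
      (Finset.le_sup' u (Finset.mem_univ _))) (Finset.le_sup' u (Finset.mem_univ _))

variable {n : ℕ}

lemma allocations_finite : (allocations n).Finite := by
  refine Set.Finite.subset (Set.Finite.pi' fun k => Set.Finite.pi' fun l =>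
    (Set.toFinite ({0, 1} : Set ℝ))) fun A hA k l => ?_
  simpa using hA.1 k l

lemma allocations_nonempty : (allocations n).Nonempty :=
  ⟨fun _ l => if l = 0 then 1 else 0, fun k l => by by_cases h : l = 0 <;> simp [h],
    fun k => by simp⟩

lemma optimalLoad_le {c : ℂ → ℝ} {x : Fin n → ℂ} {A : Matrix (Fin n) (Fin 3) ℝ}
    (hA : A ∈ allocations n) : optimalLoad c x ≤ load c A x :=
  csInf_le (allocations_finite.image _).bddBelow ⟨A, hA, rfl⟩

lemma exists_entry_eq_one {A : Matrix (Fin n) (Fin 3) ℝ} (hA : A ∈ allocations n) (k : Fin n) :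
    ∃ l, A k l = 1 ∧ ∀ m, m ≠ l → A k m = 0 := by
  have h2 := hA.2 k
  rcases hA.1 k 0 with h0 | h0 <;> rcases hA.1 k 1 with h1 | h1 <;>
    rcases hA.1 k 2 with h3 | h3 <;> rw [h0, h1, h3] at h2 <;> norm_num at h2
  · exact ⟨2, h3, fun m hm => by fin_cases m <;> simp_all⟩
  · exact ⟨1, h1, fun m hm => by fin_cases m <;> simp_all⟩
  · exact ⟨0, h0, fun m hm => by fin_cases m <;> simp_all⟩

lemma sum_entry_mul {A : Matrix (Fin n) (Fin 3) ℝ} {k : Fin n} {l : Fin 3} (h1 : A k l = 1)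
    (h0 : ∀ m, m ≠ l → A k m = 0) (u : Fin 3 → ℝ) : ∑ m, A k m * u m = u l := by
  rw [Finset.sum_eq_single l (fun m _ hm => by rw [h0 m hm, zero_mul]) (by simp), h1, one_mul]

/-- The mean of the loads of an allocation to least costly bins is a lower bound. -/
lemma sum_div_three_le_optimalLoad {c : ℂ → ℝ} {x : Fin n → ℂ} {A₀ : Matrix (Fin n) (Fin 3) ℝ}
    (hA₀ : A₀ ∈ allocations n)
    (hmin : ∀ k l, A₀ k l = 1 → ∀ m, cost c l (x k) ≤ cost c m (x k)) :
    (∑ l, ∑ k, A₀ k l * cost c l (x k)) / 3 ≤ optimalLoad c x := by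
  refine le_csInf (allocations_nonempty.image _) ?_
  rintro _ ⟨A, hA, rfl⟩
  have h1 : ∑ l, ∑ k, A₀ k l * cost c l (x k) ≤ ∑ l, ∑ k, A k l * cost c l (x k) := by
    rw [Finset.sum_comm, Finset.sum_comm (γ := Fin 3)]
    refine Finset.sum_le_sum fun k _ => ?_
    obtain ⟨l, hl1, hl0⟩ := exists_entry_eq_one hA₀ k
    obtain ⟨m, hm1, hm0⟩ := exists_entry_eq_one hA k
    rw [sum_entry_mul hl1 hl0 fun l => cost c l (x k),
      sum_entry_mul hm1 hm0 fun l => cost c l (x k)]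
    exact hmin k l hl1 m
  have h2 : ∀ l, ∑ k, A k l * cost c l (x k) ≤ load c A x := fun l =>
    Finset.le_sup' (fun l => ∑ k, A k l * cost c l (x k)) (Finset.mem_univ l)
  have h3 := Finset.sum_le_sum fun l (_ : l ∈ Finset.univ) => h2 l
  simp only [Finset.sum_const, Finset.card_univ, Fintype.card_fin, nsmul_eq_mul] at h3
  push_cast at h3
  linarith

/-- Moving the objects in `t l m` from the bin `l` to the bin `m`. -/
lemma transfer_mem_allocations {A₀ : Matrix (Fin n) (Fin 3) ℝ} (hA₀ : A₀ ∈ allocations n)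
    {t : Fin 3 → Fin 3 → Finset (Fin n)} (ht : ∀ l m, ∀ k ∈ t l m, A₀ k l = 1 ∧ l ≠ m)
    (hdisj : ∀ l m m', ∀ k ∈ t l m, k ∈ t l m' → m = m') :
    (fun k l => A₀ k l - ∑ m, (if k ∈ t l m then (1 : ℝ) else 0) +
      ∑ m, (if k ∈ t m l then (1 : ℝ) else 0)) ∈ allocations n := by
  refine ⟨fun k l => ?_, fun k => ?_⟩
  · obtain ⟨p, hp1, hp0⟩ := exists_entry_eq_one hA₀ k
    have hnot : ∀ l m, l ≠ p → k ∉ t l m := fun l m hl hk => by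
      have := (ht l m k hk).1
      rw [hp0 l hl] at this
      exact zero_ne_one this
    by_cases hq : ∃ q, k ∈ t p q
    · obtain ⟨q, hq⟩ := hq
      have hpq := (ht p q k hq).2
      have hiff : ∀ l m, k ∈ t l m ↔ l = p ∧ m = q := fun l m => by
        refine ⟨fun h => ?_, fun h => h.1 ▸ h.2 ▸ hq⟩
        by_cases hl : l = p
        · subst hl; exact ⟨rfl, hdisj l m q k h hq⟩
        · exact absurd h (hnot l m hl)
      simp only [hiff]
      by_cases hl : l = p
      · subst hl; simp [hp1, hpq]
      · by_cases hlq : l = q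
        · subst hlq; simp [hp0 l hl, hl]
        · simp [hp0 l hl, hl, hlq]
    · have : ∀ l m, k ∉ t l m := fun l m h => by
        by_cases hl : l = p
        · subst hl; exact hq ⟨m, h⟩
        · exact hnot l m hl h
      simpa [this] using hA₀.1 k l
  · have := hA₀.2 k
    simp only [Fin.sum_univ_three]
    linarith

/-- Rebalancing: the loads of an allocation can be equalized by moving objects for which two bins
are almost equally costly. -/
theorem exists_rebalanced_allocation {A₀ : Matrix (Fin n) (Fin 3) ℝ} (hA₀ : A₀ ∈ allocations n)
    {a : Fin 3 → Fin n → ℝ} {R : Fin 3 → Fin 3 → Finset (Fin n)}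
    (hR : ∀ l m, ∀ k ∈ R l m, A₀ k l = 1 ∧ l ≠ m)
    (hdisj : ∀ l m m', ∀ k ∈ R l m, k ∈ R l m' → m = m') {B η δ M : ℝ} (hB : 0 ≤ B) (hη : 0 ≤ η)
    (hδ : 0 < δ) (haB : ∀ l k, a l k ≤ B) (haδ : ∀ l m, ∀ k ∈ R l m, δ ≤ a l k)
    (haη : ∀ l m, ∀ k ∈ R l m, a m k ≤ a l k + η)
    (hM : ∀ l m, ∑ k, A₀ k l * a l k - ∑ k, A₀ k m * a m k ≤ M)
    (hRM : ∀ l m, l ≠ m → M / 3 ≤ δ * (R l m).card) :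
    ∃ A ∈ allocations n, ∀ l, ∑ k, A k l * a l k ≤
      (∑ m, ∑ k, A₀ k m * a m k) / 3 + 3 * (B + η * ((M / 3 + B) / δ)) := by
  set S : Fin 3 → ℝ := fun l => ∑ k, A₀ k l * a l k with hS
  have hM0 : 0 ≤ M := by simpa using hM 0 0
  -- The load that bin `l` should send to bin `m`. The net outflow `∑ m, (S l - S m) / 3` is exactly
  -- the excess of `S l` over the mean of the loads.
  set b : Fin 3 → Fin 3 → ℝ := fun l m => max ((S l - S m) / 3) 0 with hb
  have hbM : ∀ l m, b l m ≤ M / 3 := fun l m => max_le (by linarith [hM l m]) (by linarith)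
  have hex : ∀ l m, ∃ t ⊆ R l m, b l m ≤ ∑ k ∈ t, a l k ∧ ∑ k ∈ t, a l k ≤ b l m + B := by
    intro l m
    refine exists_subset_sum_mem_Icc _ (fun k _ => haB l k) hB (le_max_right _ _) ?_
    have hcard : δ * (R l m).card ≤ ∑ k ∈ R l m, a l k := by
      rw [mul_comm, ← nsmul_eq_mul]
      exact Finset.card_nsmul_le_sum _ _ _ fun k hk => haδ l m k hk
    by_cases hlm : l = m
    · subst hlm
      refine le_trans ?_ hcard
      simp only [hb, sub_self, zero_div, max_self]
      positivity
    · exact (hbM l m).trans ((hRM l m hlm).trans hcard)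
  choose t htR htb htB using hex
  -- Each moved object carries at least `δ`, so bounding the moved load bounds their number; each
  -- one costs its new bin at most `η` extra.
  have hcard : ∀ l m, ((t l m).card : ℝ) ≤ (M / 3 + B) / δ := fun l m => by
    rw [le_div_iff₀ hδ, ← nsmul_eq_mul]
    exact (Finset.card_nsmul_le_sum _ _ _ fun k hk => haδ l m k (htR l m hk)).trans
      ((htB l m).trans (by linarith [hbM l m]))
  refine ⟨_, transfer_mem_allocations hA₀ (fun l m k hk => hR l m k (htR l m hk))
    (fun l m m' k hk hk' => hdisj l m m' k (htR l m hk) (htR l m' hk')), fun l => ?_⟩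
  have hload : ∑ k, (A₀ k l - ∑ m, (if k ∈ t l m then (1 : ℝ) else 0) +
      ∑ m, (if k ∈ t m l then (1 : ℝ) else 0)) * a l k =
      S l - ∑ m, ∑ k ∈ t l m, a l k + ∑ m, ∑ k ∈ t m l, a l k := by
    have h1 : ∀ r : Fin 3 → Finset (Fin n),
        ∑ k, (∑ m, if k ∈ r m then (1 : ℝ) else 0) * a l k = ∑ m, ∑ k ∈ r m, a l k := fun r => by
      simp_rw [Finset.sum_mul]
      rw [Finset.sum_comm]
      exact Finset.sum_congr rfl fun m _ => by simp [Finset.sum_ite_mem]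
    simp_rw [add_mul, sub_mul, Finset.sum_add_distrib, Finset.sum_sub_distrib]
    rw [h1, h1]
  rw [hload]
  have hin : ∀ m, ∑ k ∈ t m l, a l k ≤ b m l + B + η * ((M / 3 + B) / δ) := fun m => by
    calc ∑ k ∈ t m l, a l k ≤ ∑ k ∈ t m l, (a m k + η) :=
          Finset.sum_le_sum fun k hk => haη m l k (htR m l hk)
      _ = ∑ k ∈ t m l, a m k + η * (t m l).card := by
          rw [Finset.sum_add_distrib, Finset.sum_const, nsmul_eq_mul, mul_comm]
      _ ≤ _ := by gcongr; exacts [htB m l, hcard m l]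
  -- Positive part minus negative part. Outflow is at least its target, so only inflow contributes
  -- an error: `B` from overshoot plus `η` per object, for each of three values of `m`.
  have hnet : ∀ m, b m l - b l m = (S m - S l) / 3 := fun m => by
    simp only [hb]
    rcases le_total (S l) (S m) with h | h
    · rw [max_eq_left (by linarith), max_eq_right (by linarith)]; ring
    · rw [max_eq_right (by linarith), max_eq_left (by linarith)]; ring
  have hterm : ∀ m, ∑ k ∈ t m l, a l k - ∑ k ∈ t l m, a l k ≤
      (S m - S l) / 3 + (B + η * ((M / 3 + B) / δ)) := fun m => by
    linarith [hin m, htb l m, hnet m]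
  have h0 := hterm 0
  have h1 := hterm 1
  have h2 := hterm 2
  simp only [Fin.sum_univ_three]
  linarith

end Allocation

/-! ### Geometry of the triangle, the separating rays and the cells -/

section Geometry

lemma j_eq : j = ⟨-1 / 2, √3 / 2⟩ := by
  rw [j, show (2 * Real.pi * Complex.I / 3 : ℂ) = ((2 * Real.pi / 3 : ℝ) : ℂ) * Complex.I by
    push_cast; ring, Complex.exp_mul_I, ← Complex.ofReal_cos, ← Complex.ofReal_sin,
    show 2 * Real.pi / 3 = Real.pi - Real.pi / 3 by ring, Real.cos_pi_sub, Real.sin_pi_sub,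
    Real.cos_pi_div_three, Real.sin_pi_div_three]
  apply Complex.ext <;> simp
  norm_num

lemma sqrt_three_sq : √3 ^ 2 = (3 : ℝ) := Real.sq_sqrt (by norm_num)

lemma sqrt_three_mul_self : √3 * √3 = (3 : ℝ) := Real.mul_self_sqrt (by norm_num)

lemma j_sq : j ^ 2 = ⟨-1 / 2, -(√3 / 2)⟩ := by
  rw [j_eq, sq]
  apply Complex.ext <;> simp <;> linarith [sqrt_three_mul_self]

lemma j_cube : j ^ 3 = 1 := by
  rw [pow_succ, j_sq, j_eq]
  apply Complex.ext <;> simp <;> linarith [sqrt_three_mul_self]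

lemma norm_j : ‖j‖ = 1 := by
  have h : ‖j‖ ^ 3 = 1 := by rw [← norm_pow, j_cube, norm_one]
  exact (pow_eq_one_iff_of_nonneg (norm_nonneg _) (by norm_num)).1 h

lemma j_ne_zero : j ≠ 0 := norm_ne_zero_iff.1 (by rw [norm_j]; exact one_ne_zero)

lemma circumradius_pos : 0 < circumradius := by unfold circumradius; positivity

lemma circumradius_sq : circumradius ^ 2 = 4 * √3 / 9 := by
  rw [circumradius, div_pow, Real.sq_sqrt (by positivity)]
  field_simp
  linarith [sqrt_three_sq]

lemma bin_zero : bin 0 = ⟨√3 / 2 * circumradius, -(circumradius / 2)⟩ := by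
  simp only [bin, Matrix.cons_val_zero, j_sq]
  apply Complex.ext <;> simp
  ring

lemma bin_one : bin 1 = ⟨0, circumradius⟩ := by
  simp only [bin, Matrix.cons_val_one, Matrix.cons_val_zero]
  apply Complex.ext <;> simp

lemma bin_two : bin 2 = ⟨-(√3 / 2 * circumradius), -(circumradius / 2)⟩ := by
  simp only [bin, Matrix.cons_val, j_eq]
  apply Complex.ext <;> simp
  ring

/-- The coordinate of `x` in the direction of the bin `l`. -/
noncomputable def height (l : Fin 3) (x : ℂ) : ℝ :=
  ![(√3 * x.re - x.im) / 2, x.im, (-(√3 * x.re) - x.im) / 2] l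

lemma height_zero (x : ℂ) : height 0 x = (√3 * x.re - x.im) / 2 := rfl

lemma height_one (x : ℂ) : height 1 x = x.im := rfl

lemma height_two (x : ℂ) : height 2 x = (-(√3 * x.re) - x.im) / 2 := rfl

lemma height_sum (x : ℂ) : height 0 x + height 1 x + height 2 x = 0 := by
  rw [height_zero, height_one, height_two]; ring

lemma continuous_height (l : Fin 3) : Continuous (height l) := by
  change Continuous fun x => height l x
  simp only [height]
  fin_cases l <;> simp <;> fun_prop

lemma height_combo (l : Fin 3) (a b : ℝ) (x y : ℂ) :
    height l (a • x + b • y) = a * height l x + b * height l y := by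
  fin_cases l <;> simp [height] <;> ring

lemma height_j_mul (l : Fin 3) (x : ℂ) : height (l + 1) (j * x) = height l x := by
  rw [j_eq]
  fin_cases l
  · simp [height]
    ring
  · simp [height]
    linear_combination (x.im / 4) * sqrt_three_mul_self
  · simp [height]
    linear_combination (-x.im / 2) * sqrt_three_mul_self

lemma height_bin_self (l : Fin 3) : height l (bin l) = circumradius := by
  fin_cases l
  · simp only [Fin.zero_eta, height_zero, bin_zero]
    linear_combination (circumradius / 4) * sqrt_three_mul_self
  · simp [height_one, bin_one]
  · simp only [Fin.reduceFinMk, height_two, bin_two]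
    linear_combination (circumradius / 4) * sqrt_three_mul_self

lemma height_bin_of_ne {l m : Fin 3} (h : l ≠ m) : height l (bin m) = -(circumradius / 2) := by
  fin_cases l <;> fin_cases m <;>
    simp [height_zero, height_one, height_two, bin_zero, bin_one, bin_two] at h ⊢ <;>
    first | ring1 | linear_combination (-circumradius / 4) * sqrt_three_mul_self

/-- The inner product of `x` with `bin l` is `circumradius * height l x`, and all bins have norm
`circumradius`. Hence comparing distances to bins amounts to comparing the linear functions
`height`. -/
lemma norm_sub_bin_sq (l : Fin 3) (x : ℂ) :
    ‖x - bin l‖ ^ 2 = ‖x‖ ^ 2 + circumradius ^ 2 - 2 * circumradius * height l x := by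
  simp only [Complex.sq_norm, Complex.normSq_apply]
  fin_cases l
  · simp only [Fin.zero_eta, height_zero, bin_zero, Complex.sub_re, Complex.sub_im]
    linear_combination (circumradius ^ 2 / 4) * sqrt_three_mul_self
  · simp only [Fin.mk_one, height_one, bin_one, Complex.sub_re, Complex.sub_im]
    ring
  · simp only [Fin.reduceFinMk, height_two, bin_two, Complex.sub_re, Complex.sub_im]
    linear_combination (circumradius ^ 2 / 4) * sqrt_three_mul_self

lemma norm_sub_bin_le_iff (l m : Fin 3) (x : ℂ) :
    ‖x - bin l‖ ≤ ‖x - bin m‖ ↔ height m x ≤ height l x := by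
  have hc := circumradius_pos
  rw [← sq_le_sq₀ (norm_nonneg _) (norm_nonneg _), norm_sub_bin_sq, norm_sub_bin_sq]
  constructor <;> intro h <;> nlinarith

lemma norm_sub_bin_lt_iff (l m : Fin 3) (x : ℂ) :
    ‖x - bin l‖ < ‖x - bin m‖ ↔ height m x < height l x := by
  rw [← not_le, norm_sub_bin_le_iff, not_le]

lemma eq_zero_of_height_eq {x : ℂ} (h₁ : height 0 x = height 1 x)
    (h₂ : height 1 x = height 2 x) : x = 0 := by
  have h := height_sum x
  rw [height_zero, height_one] at h₁
  have him : x.im = 0 := by rw [← height_one]; rw [height_one] at *; linarith [height_zero x]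
  have h3 := Real.sqrt_pos.2 (show (0 : ℝ) < 3 by norm_num)
  have hre : √3 * x.re = 0 := by rw [him] at h₁; linarith
  exact Complex.ext ((mul_eq_zero.1 hre).resolve_left h3.ne') him

lemma mem_triangle_iff {x : ℂ} : x ∈ triangle ↔ ∀ l, -(circumradius / 2) ≤ height l x := by
  have hc := circumradius_pos
  constructor
  · intro hx
    refine (convexHull_min (s := Set.range bin)
      (t := {y | ∀ l, -(circumradius / 2) ≤ height l y}) ?_ ?_) hx
    · rintro _ ⟨m, rfl⟩ l
      by_cases h : l = m
      · subst h; rw [height_bin_self]; linarith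
      · rw [height_bin_of_ne h]
    · intro y hy z hz a b ha hb hab l
      rw [height_combo]
      have h1 := mul_le_mul_of_nonneg_left (hy l) ha
      have h2 := mul_le_mul_of_nonneg_left (hz l) hb
      have h3 : a * -(circumradius / 2) + b * -(circumradius / 2) = -(circumradius / 2) := by
        rw [← add_mul, hab, one_mul]
      linarith
  · intro h
    -- These weights are the barycentric coordinates of `x`; they are nonnegative exactly under the
    -- height bounds, and sum to `1` because the heights sum to `0`.
    have hx : x = ∑ l, ((1 + 2 * height l x / circumradius) / 3) • bin l := by
      apply Complex.ext <;>
      simp only [Fin.sum_univ_three, Complex.add_re, Complex.add_im, Complex.smul_re,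
        Complex.smul_im, smul_eq_mul, height_zero, height_one, height_two, bin_zero, bin_one,
        bin_two] <;> field_simp
      · linear_combination (-2 * x.re * circumradius) * sqrt_three_sq
      · ring
    rw [hx]
    refine (convex_convexHull ℝ _).sum_mem (fun l _ => ?_) ?_
      fun l _ => subset_convexHull ℝ _ ⟨l, rfl⟩
    · have : -1 ≤ 2 * height l x / circumradius := by
        rw [le_div_iff₀ hc]; linarith [h l]
      linarith
    · have := height_sum x
      rw [Fin.sum_univ_three]
      field_simp
      linarith

lemma isCompact_triangle : IsCompact triangle :=
  (Set.finite_range bin).isCompact_convexHull ℝ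

lemma measurableSet_triangle : MeasurableSet triangle := isCompact_triangle.measurableSet

lemma forall_fin_three_add_one {p : Fin 3 → Prop} : (∀ l, p (l + 1)) ↔ ∀ l, p l :=
  ⟨fun h l => by simpa using h (l - 1), fun h l => h _⟩

lemma j_mul_mem_triangle {x : ℂ} : j * x ∈ triangle ↔ x ∈ triangle := by
  rw [mem_triangle_iff, mem_triangle_iff, ← forall_fin_three_add_one]
  simp_rw [height_j_mul]

lemma j_sq_mul_mem_triangle {x : ℂ} : j ^ 2 * x ∈ triangle ↔ x ∈ triangle := by
  rw [sq, mul_assoc, j_mul_mem_triangle, j_mul_mem_triangle]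

/-- The triangle has unit area. -/
lemma volume_triangle : volume triangle = 1 := by
  have hc := circumradius_pos
  have h3 : 0 < √3 := by positivity
  have hmp := Complex.volume_preserving_equiv_real_prod.symm
  rw [← hmp.measure_preimage measurableSet_triangle.nullMeasurableSet, Measure.volume_eq_prod,
    Measure.prod_apply_symm (hmp.measurable measurableSet_triangle)]
  -- The horizontal slice at ordinate `y` is an interval of half-width `(circumradius - y) / √3`.
  -- Integrating gives `9 λ² / (4 √3) = 1`, with `λ` the circumradius.
  have hsec : ∀ y : ℝ, volume ((fun x : ℝ => (x, y)) ⁻¹'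
      (Complex.measurableEquivRealProd.symm ⁻¹' triangle)) =
      (Set.Icc (-(circumradius / 2)) circumradius).indicator
        (fun y => ENNReal.ofReal (2 * (circumradius - y) / √3)) y := by
    intro y
    have hset : ((fun x : ℝ => (x, y)) ⁻¹' (Complex.measurableEquivRealProd.symm ⁻¹' triangle)) =
        {x | -(circumradius / 2) ≤ y ∧
          x ∈ Set.Icc (-((circumradius - y) / √3)) ((circumradius - y) / √3)} := by
      ext x
      simp only [Set.mem_preimage, mem_triangle_iff, Set.mem_ofPred_eq, Set.mem_Icc,
        Complex.measurableEquivRealProd_symm_apply, Fin.forall_fin_succ, Fin.succ_zero_eq_one,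
        Fin.succ_one_eq_two, height_zero, height_one, height_two, ← neg_div]
      rw [div_le_iff₀ h3, le_div_iff₀ h3]
      simp only [IsEmpty.forall_iff, and_true]
      constructor
      · rintro ⟨h1, h2, h4⟩
        exact ⟨h2, by linarith, by linarith⟩
      · rintro ⟨h1, h2, h4⟩
        exact ⟨by linarith, h1, by linarith⟩
    rw [hset]
    by_cases hy : y ∈ Set.Icc (-(circumradius / 2)) circumradius
    · rw [Set.indicator_of_mem hy]
      simp only [hy.1, true_and, Set.ofPred_mem_eq, Real.volume_Icc]
      congr 1
      ring
    · rw [Set.indicator_of_notMem hy]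
      rw [Set.mem_Icc, not_and_or] at hy
      rcases hy with hy | hy
      · simp [hy]
      · have : (circumradius - y) / √3 < 0 := div_neg_of_neg_of_pos (by linarith) h3
        refine measure_mono_null (t := ∅) ?_ measure_empty
        rintro x ⟨-, h1, h2⟩
        linarith
  simp_rw [hsec]
  rw [lintegral_indicator measurableSet_Icc, ← ofReal_integral_eq_lintegral_ofReal,
    integral_Icc_eq_integral_Ioc, ← intervalIntegral.integral_of_le (by linarith)]
  · simp only [intervalIntegral.integral_div, intervalIntegral.integral_const_mul]
    rw [intervalIntegral.integral_sub (by simp) (by simp)]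
    simp only [intervalIntegral.integral_const, integral_id, smul_eq_mul]
    rw [← ENNReal.ofReal_one]
    congr 1
    field_simp
    linarith [circumradius_sq]
  · exact (Continuous.integrableOn_Icc (by fun_prop))
  · filter_upwards [ae_restrict_mem measurableSet_Icc] with y hy
    have := hy.2
    simp only [Pi.zero_apply]
    exact div_nonneg (by linarith) h3.le

/-- The ray `D₁` is the locus where bins `0` and `1` tie as nearest, without the origin. Likewise
rays `1` and `2` separate bins `1, 2` and `2, 0`, but they contain the origin. -/
lemma mem_ray_zero_iff {x : ℂ} : x ∈ ray 0 ↔ height 0 x = height 1 x ∧ height 2 x < 0 := by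
  have h3 : 0 < √3 := by positivity
  simp only [ray, Matrix.cons_val_zero, Set.mem_ofPred_eq, j_eq, height_zero, height_one,
    height_two]
  constructor
  · rintro ⟨t, ht, rfl⟩
    simp
    constructor <;> nlinarith [sqrt_three_mul_self]
  · rintro ⟨h1, h2⟩
    refine ⟨-2 * x.im, by linarith, ?_⟩
    apply Complex.ext <;> simp
    · apply mul_left_cancel₀ h3.ne'
      linear_combination 2 * h1 - x.im * sqrt_three_mul_self
    · ring

lemma mem_ray_one_iff {x : ℂ} : x ∈ ray 1 ↔ height 1 x = height 2 x ∧ height 0 x ≤ 0 := by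
  have h3 : 0 < √3 := by positivity
  simp only [ray, Matrix.cons_val_one, Matrix.cons_val_zero, Set.mem_ofPred_eq, j_sq, height_zero,
    height_one, height_two]
  constructor
  · rintro ⟨t, ht, rfl⟩
    simp
    constructor <;> nlinarith [sqrt_three_mul_self]
  · rintro ⟨h1, h2⟩
    refine ⟨-2 * x.im, by linarith, ?_⟩
    apply Complex.ext <;> simp
    · apply mul_left_cancel₀ h3.ne'
      linear_combination 2 * h1 + x.im * sqrt_three_mul_self
    · ring

lemma mem_ray_two_iff {x : ℂ} : x ∈ ray 2 ↔ height 2 x = height 0 x ∧ height 1 x ≤ 0 := by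
  have h3 : 0 < √3 := by positivity
  simp only [ray, Matrix.cons_val, Set.mem_ofPred_eq, j_cube, height_zero,
    height_one, height_two]
  constructor
  · rintro ⟨t, ht, rfl⟩
    simpa using ht
  · rintro ⟨h1, h2⟩
    have hre : √3 * x.re = 0 := by linarith
    refine ⟨x.im, h2, ?_⟩
    apply Complex.ext <;> simp
    exact (mul_eq_zero.1 hre).resolve_left h3.ne'

/-- Removing `ray l` takes away the boundary with cell `l + 1` and keeps the one with cell `l + 2`.
The origin goes to cell `0`, as `ray 0` alone omits it. The cells therefore partition the triangle.
-/
lemma mem_cell_iff {l : Fin 3} {x : ℂ} : x ∈ cell l ↔ x ∈ triangle ∧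
    height (l + 2) x ≤ height l x ∧ (height (l + 1) x < height l x ∨ l = 0 ∧ x = 0) := by
  have hs := height_sum x
  have h0 : height 0 x = height 1 x → height 1 x = height 2 x → x = 0 := eq_zero_of_height_eq
  have h0' : x = 0 → height 0 x = 0 ∧ height 1 x = 0 ∧ height 2 x = 0 := by
    rintro rfl; simp [height_zero, height_one, height_two]
  simp only [cell, Set.mem_sdiff, Set.mem_ofPred_eq, norm_sub_bin_le_iff]
  rw [and_assoc]
  refine and_congr_right fun _ => ?_
  simp only [Fin.forall_fin_succ, Fin.succ_zero_eq_one, Fin.succ_one_eq_two, IsEmpty.forall_iff,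
    and_true]
  fin_cases l
  · simp only [Fin.zero_eta, mem_ray_zero_iff, zero_add]
    grind
  · simp only [Fin.mk_one, mem_ray_one_iff, Fin.reduceAdd]
    grind
  · simp only [Fin.reduceFinMk, mem_ray_two_iff, Fin.reduceAdd]
    grind

end Geometry

/-! ### Symmetries and comparison of the costs -/

section Cost

variable {c : ℂ → ℝ}

lemma cell_subset_triangle (l : Fin 3) : cell l ⊆ triangle := fun _ hx => hx.1.1

lemma exists_unique_mem_cell {x : ℂ} (hx : x ∈ triangle) :
    ∃ l, x ∈ cell l ∧ ∀ m, m ≠ l → x ∉ cell m := by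
  have h0 : height 0 x = height 1 x → height 1 x = height 2 x → x = 0 := eq_zero_of_height_eq
  have h0' : x = 0 → height 0 x = 0 ∧ height 1 x = 0 ∧ height 2 x = 0 := by
    rintro rfl; simp [height_zero, height_one, height_two]
  simp only [mem_cell_iff, hx, true_and, Fin.exists_fin_succ, Fin.forall_fin_succ]
  simp
  grind

lemma cellMatrix_mem_allocations {n : ℕ} {x : Fin n → ℂ} (hx : ∀ k, x k ∈ triangle) :
    cellMatrix x ∈ allocations n := by
  classical
  refine ⟨fun k l => ?_, fun k => ?_⟩
  · by_cases h : x k ∈ cell l <;> simp [cellMatrix, h]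
  · obtain ⟨l, hl, hm⟩ := exists_unique_mem_cell (hx k)
    have : cellMatrix x k 0 + cellMatrix x k 1 + cellMatrix x k 2 = ∑ m, cellMatrix x k m := by
      rw [Fin.sum_univ_three]
    rw [this, Finset.sum_eq_single l]
    · simp [cellMatrix, hl]
    · intro m _ hml
      simp [cellMatrix, hm m hml]
    · simp

/-- Multiplication by `j` permutes the bins cyclically, so facts about bin `0` transfer to the
others. -/
lemma cost_j_mul (l : Fin 3) (x : ℂ) : cost c (l + 1) (j * x) = cost c l x := by
  have h3 := j_cube
  fin_cases l
  · change c (j ^ 2 * (j * x)) = c x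
    rw [show j ^ 2 * (j * x) = j ^ 3 * x by ring, h3, one_mul]
  · change c (j * (j * x)) = c (j ^ 2 * x)
    rw [← mul_assoc, sq]
  · rfl

/-- A property of pairs of bins that is invariant under rotation holds if it holds for pairs with
first member `0`. -/
lemma forall_of_rotation {p : Fin 3 → Fin 3 → ℂ → Prop}
    (hrot : ∀ l m x, p (l + 1) (m + 1) (j * x) → p l m x) (h : ∀ m x, p 0 m x) :
    ∀ l m x, p l m x := by
  have h2 : ∀ m x, p 2 m x := fun m x => hrot 2 m x (h _ _)
  have h1 : ∀ m x, p 1 m x := fun m x => hrot 1 m x (h2 _ _)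
  intro l
  fin_cases l
  exacts [h, h1, h2]

lemma cost_lt_cost
    (hnear : ∀ x ∈ triangle, ∀ l : Fin 3, l ≠ 0 → ‖x - bin 0‖ < ‖x - bin l‖ →
      cost c 0 x < cost c l x) (l m : Fin 3) (x : ℂ) (hx : x ∈ triangle)
    (h : height m x < height l x) : cost c l x < cost c m x := by
  revert hx h
  refine forall_of_rotation
    (p := fun l m x => x ∈ triangle → height m x < height l x → cost c l x < cost c m x)
    (fun l m x => ?_) (fun m x hx h => ?_) l m x
  · simp only [height_j_mul, cost_j_mul, j_mul_mem_triangle, imp_self]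
  · exact hnear x hx m (by rintro rfl; exact lt_irrefl _ h) ((norm_sub_bin_lt_iff _ _ _).2 h)

/-- Since `-j = exp (-iπ/3)`, the polar condition says that `c` is invariant under `x ↦ -j x̄`, the
reflection in the line through `0` and `bin 0`. The origin, excluded by `t > 0`, is a fixed point.
-/
lemma cost_conj
    (hsymm : ∀ θ ∈ Set.Icc (0 : ℝ) (2 * Real.pi), ∀ t : ℝ, 0 < t →
      (t : ℂ) * Complex.exp (Complex.I * θ) ∈ triangle →
      c (t * Complex.exp (Complex.I * θ)) =
        c (t * Complex.exp (-(Complex.I * θ) - Complex.I * Real.pi / 3)))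
    {x : ℂ} (hx : x ∈ triangle) : c (-j * (starRingEnd ℂ) x) = c x := by
  rcases eq_or_ne x 0 with rfl | hx0
  · simp
  have hj : -j = Complex.exp (-(Complex.I * Real.pi / 3)) := by
    rw [j_eq, show (-(Complex.I * Real.pi / 3) : ℂ) = ((-(Real.pi / 3) : ℝ) : ℂ) * Complex.I by
      push_cast; ring, Complex.exp_mul_I, ← Complex.ofReal_cos, ← Complex.ofReal_sin,
      Real.cos_neg, Real.sin_neg, Real.cos_pi_div_three, Real.sin_pi_div_three]
    apply Complex.ext <;> simp
    norm_num
  -- The principal argument lies in `(-π, π]`; negative values are shifted by `2π` into the range of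
  -- the hypothesis.
  obtain ⟨θ, hθ, hxθ⟩ : ∃ θ ∈ Set.Icc (0 : ℝ) (2 * Real.pi),
      x = (‖x‖ : ℂ) * Complex.exp (Complex.I * θ) := by
    have hpolar := Complex.norm_mul_exp_arg_mul_I x
    have h1 := Complex.neg_pi_lt_arg x
    have h2 := Complex.arg_le_pi x
    rcases le_total 0 x.arg with h | h
    · exact ⟨x.arg, ⟨h, by linarith [Real.pi_pos]⟩, by rw [mul_comm Complex.I, hpolar]⟩
    · refine ⟨x.arg + 2 * Real.pi, ⟨by linarith, by linarith⟩, ?_⟩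
      push_cast
      rw [mul_add, Complex.exp_add, mul_comm Complex.I (2 * Real.pi : ℂ),
        Complex.exp_two_pi_mul_I, mul_one, mul_comm Complex.I, hpolar]
  have hconj : (starRingEnd ℂ) x = (‖x‖ : ℂ) * Complex.exp (-(Complex.I * θ)) := by
    conv_lhs => rw [hxθ]
    rw [map_mul, ← Complex.exp_conj]
    simp
  have h := hsymm θ hθ ‖x‖ (norm_pos_iff.2 hx0) (by rwa [← hxθ])
  rw [← hxθ] at h
  rw [h, hconj, hj]
  congr 1
  rw [sub_eq_add_neg, Complex.exp_add]
  ring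

/-- On the line equidistant from bins `0` and `m`, the rotation that defines `cost c m` coincides
with the reflection `x ↦ -j x̄`, which leaves `c` unchanged. Rotation gives the other pairs. -/
lemma cost_eq_cost (hconj : ∀ x ∈ triangle, c (-j * (starRingEnd ℂ) x) = c x)
    (l m : Fin 3) (x : ℂ) (hx : x ∈ triangle)
    (h : height m x = height l x) : cost c m x = cost c l x := by
  revert hx h
  refine forall_of_rotation
    (p := fun l m x => x ∈ triangle → height m x = height l x → cost c m x = cost c l x)
    (fun l m x => ?_) (fun m x hx h => ?_) l m x
  · simp only [height_j_mul, cost_j_mul, j_mul_mem_triangle, imp_self]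
  · have h3 : 0 < √3 := by positivity
    rw [← show c x = cost c 0 x from rfl, ← hconj x hx]
    fin_cases m
    · exact (hconj x hx).symm
    · change c (j ^ 2 * x) = _
      congr 1
      simp only [Fin.mk_one, height_one, height_zero] at h
      rw [j_sq, j_eq]
      apply Complex.ext <;> simp
      · have hre : x.re = √3 * x.im := mul_left_cancel₀ h3.ne' <| by
          linear_combination -2 * h - x.im * sqrt_three_mul_self
        linarith
      · ring
    · change c (j * x) = _
      congr 1
      simp only [Fin.reduceFinMk, height_two, height_zero] at h
      have hre : √3 * x.re = 0 := by linarith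
      have hre : x.re = 0 := (mul_eq_zero.1 hre).resolve_left h3.ne'
      rw [j_eq]
      apply Complex.ext <;> simp [hre]

lemma cost_le_cost (hconj : ∀ x ∈ triangle, c (-j * (starRingEnd ℂ) x) = c x)
    (hnear : ∀ x ∈ triangle, ∀ l : Fin 3, l ≠ 0 → ‖x - bin 0‖ < ‖x - bin l‖ →
      cost c 0 x < cost c l x) {l : Fin 3} {x : ℂ} (hx : x ∈ cell l) (m : Fin 3) :
    cost c l x ≤ cost c m x := by
  have hm := (norm_sub_bin_le_iff _ _ _).1 (hx.1.2 m)
  rcases hm.lt_or_eq with h | h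
  · exact (cost_lt_cost hnear l m x hx.1.1 h).le
  · exact (cost_eq_cost hconj l m x hx.1.1 h).ge

lemma measurePreserving_j_mul : MeasurePreserving (fun x : ℂ => j * x) volume volume := by
  have h := (rotation ⟨j, mem_sphere_zero_iff_norm.2 norm_j⟩).measurePreserving
  convert! h using 1

lemma measurableEmbedding_j_mul : MeasurableEmbedding (fun x : ℂ => j * x) :=
  (Homeomorph.mulLeft₀ j j_ne_zero).measurableEmbedding

lemma measurableSet_cell (l : Fin 3) : MeasurableSet (cell l) := by
  have : cell l = triangle ∩ ({x | height (l + 2) x ≤ height l x} ∩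
      ({x | height (l + 1) x < height l x} ∪ {x | l = 0 ∧ x = 0})) := by
    ext x; exact mem_cell_iff
  rw [this]
  have hm := fun l => (continuous_height l).measurable
  refine measurableSet_triangle.inter ((measurableSet_le (hm _) (hm _)).inter
    ((measurableSet_lt (hm _) (hm _)).union ?_))
  by_cases h : l = 0 <;> simp [h]

lemma cost_mem_image (l : Fin 3) {x : ℂ} (hx : x ∈ triangle) : cost c l x ∈ c '' triangle := by
  fin_cases l
  exacts [⟨x, hx, rfl⟩, ⟨j ^ 2 * x, j_sq_mul_mem_triangle.2 hx, rfl⟩,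
    ⟨j * x, j_mul_mem_triangle.2 hx, rfl⟩]

lemma cost_indicator (l : Fin 3) {x : ℂ} (hx : x ∈ triangle) :
    cost (triangle.indicator c) l x = cost c l x := by
  fin_cases l
  exacts [Set.indicator_of_mem hx _, Set.indicator_of_mem (j_sq_mul_mem_triangle.2 hx) _,
    Set.indicator_of_mem (j_mul_mem_triangle.2 hx) _]

/-- Since `c` is arbitrary off the triangle, measurability is available only after truncation to it;
`cost_indicator` shows that nothing changes on the triangle. -/
lemma measurable_cost_indicator (hc : Measurable fun x : triangle => c x) (l : Fin 3) :
    Measurable (cost (triangle.indicator c) l) := by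
  have h : Measurable (triangle.indicator c) := by
    refine measurable_of_restrict_of_restrict_compl measurableSet_triangle ?_ ?_
    · convert! hc using 2 with x
      exact Set.indicator_of_mem x.2 _
    · convert! measurable_const (a := (0 : ℝ)) using 2 with x
      exact Set.indicator_of_notMem x.2 _
  fin_cases l
  exacts [h, h.comp (measurable_const_mul _), h.comp (measurable_const_mul _)]

/-- The cost of the objects in the cell `l` for the bin `l`. -/
noncomputable def cellCost (c : ℂ → ℝ) (l : Fin 3) : ℂ → ℝ := (cell l).indicator (cost c l)

lemma measurable_cellCost (hc : Measurable fun x : triangle => c x) (l : Fin 3) :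
    Measurable (cellCost c l) := by
  have : cellCost c l = (cell l).indicator (cost (triangle.indicator c) l) :=
    Set.indicator_congr fun x hx => (cost_indicator l hx.1.1).symm
  rw [this]
  exact (measurable_cost_indicator hc l).indicator (measurableSet_cell l)

lemma cellCost_mul_cellCost {l m : Fin 3} (h : l ≠ m) (x : ℂ) :
    cellCost c l x * cellCost c m x = 0 := by
  by_cases hx : x ∈ triangle
  · obtain ⟨p, -, hp⟩ := exists_unique_mem_cell hx
    by_cases hl : l = p
    · rw [cellCost, cellCost, Set.indicator_of_notMem (hp m fun hm => h (hl.trans hm.symm)),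
        mul_zero]
    · rw [cellCost, Set.indicator_of_notMem (hp l hl), zero_mul]
  · rw [cellCost, Set.indicator_of_notMem fun hx' => hx hx'.1.1, zero_mul]

/-- Rotation carries cell `l` to cell `l + 1` except at the origin, which belongs to cell `0` only.
-/
lemma cellCost_j_mul (l : Fin 3) {x : ℂ} (hx : x ≠ 0) :
    cellCost c (l + 1) (j * x) = cellCost c l x := by
  have : j * x ∈ cell (l + 1) ↔ x ∈ cell l := by
    rw [mem_cell_iff, mem_cell_iff, j_mul_mem_triangle,
      show l + 1 + 2 = (l + 2) + 1 from add_right_comm _ _ _,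
      height_j_mul, height_j_mul, height_j_mul]
    simp [hx, j_ne_zero]
  unfold cellCost
  by_cases h : x ∈ cell l
  · rw [Set.indicator_of_mem h, Set.indicator_of_mem (this.2 h), cost_j_mul]
  · rw [Set.indicator_of_notMem h, Set.indicator_of_notMem (mt this.1 h)]

/-- Rotation preserves area and the exceptional origin is a null set, so the three cells give equal
moments. For `q = 0` the power of the indicator would be `1` off the cell. -/
lemma setIntegral_cellCost_pow {q : ℕ} (hq : q ≠ 0) (l : Fin 3) :
    ∫ x in triangle, cellCost c l x ^ q = ∫ x in cell 0, c x ^ q := by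
  have hT : ∀ l, ∫ x in triangle, cellCost c l x ^ q = ∫ x, cellCost c l x ^ q := fun l => by
    refine setIntegral_eq_integral_of_forall_compl_eq_zero fun x hx => ?_
    rw [cellCost, Set.indicator_of_notMem fun hx' => hx hx'.1.1, zero_pow hq]
  have hrot : ∀ l, ∫ x, cellCost c (l + 1) x ^ q = ∫ x, cellCost c l x ^ q := fun l => by
    rw [← measurePreserving_j_mul.integral_comp measurableEmbedding_j_mul]
    refine integral_congr_ae ?_
    filter_upwards [compl_mem_ae_iff.2 (measure_singleton (0 : ℂ))] with x hx
    rw [cellCost_j_mul l hx]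
  have h0 : ∫ x, cellCost c 0 x ^ q = ∫ x in cell 0, c x ^ q := by
    rw [← integral_indicator (measurableSet_cell 0)]
    congr with x
    by_cases h : x ∈ cell 0 <;> simp [cellCost, h, hq, cost]
  rw [hT, ← h0]
  fin_cases l
  exacts [rfl, hrot 0, (hrot 1).trans (hrot 0)]

end Cost

/-! ### Strips along the cell boundaries and their areas -/

section Strip

variable {c : ℂ → ℝ}

/-- The positions that have `l` and `m` as nearest and second nearest bins, where the bin `m` is
more costly than the bin `l` by at most `η`, and where the bin `l` costs at least `δ`. -/
def strip (c : ℂ → ℝ) (η δ : ℝ) (l m : Fin 3) : Set ℂ :=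
  {x | x ∈ triangle ∧ height m x < height l x ∧
    (∀ p, p ≠ l → p ≠ m → height p x < height m x) ∧
    cost c m x ≤ cost c l x + η ∧ δ ≤ cost c l x}

variable {η δ : ℝ}

lemma strip_subset_cell (l m : Fin 3) : strip c η δ l m ⊆ cell l := by
  rintro x ⟨hx, h1, h2, -⟩
  have hlt : ∀ p, p ≠ l → height p x < height l x := fun p hp => by
    by_cases hpm : p = m
    · exact hpm ▸ h1
    · exact (h2 p hp hpm).trans h1
  rw [mem_cell_iff]
  exact ⟨hx, (hlt _ (by fin_cases l <;> decide)).le, Or.inl (hlt _ (by fin_cases l <;> decide))⟩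

lemma ne_of_mem_strip {l m : Fin 3} {x : ℂ} (hx : x ∈ strip c η δ l m) : l ≠ m := by
  rintro rfl
  exact lt_irrefl _ hx.2.1

lemma eq_of_mem_strip {l m m' : Fin 3} {x : ℂ} (h : x ∈ strip c η δ l m)
    (h' : x ∈ strip c η δ l m') : m = m' := by
  by_contra hne
  exact lt_asymm (h.2.2.1 m' (ne_of_mem_strip h').symm (Ne.symm hne))
    (h'.2.2.1 m (ne_of_mem_strip h).symm hne)

lemma measurableSet_strip (hc : Measurable fun x : triangle => c x) (l m : Fin 3) :
    MeasurableSet (strip c η δ l m) := by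
  have : strip c η δ l m = triangle ∩ ({x | height m x < height l x} ∩
      ((⋂ p, {x | p ≠ l → p ≠ m → height p x < height m x}) ∩
      ({x | cost (triangle.indicator c) m x ≤ cost (triangle.indicator c) l x + η} ∩
      {x | δ ≤ cost (triangle.indicator c) l x}))) := by
    ext x
    refine and_congr_right fun hx => ?_
    simp [cost_indicator _ hx]
  rw [this]
  have hm := fun l => (continuous_height l).measurable
  have hcost := measurable_cost_indicator hc
  refine measurableSet_triangle.inter ((measurableSet_lt (hm _) (hm _)).inter
    ((MeasurableSet.iInter fun p => ?_).inter ((measurableSet_le (hcost _)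
      ((hcost _).add_const _)).inter (measurableSet_le measurable_const (hcost _)))))
  by_cases h1 : p = l
  · simp [h1]
  · by_cases h2 : p = m
    · simp [h2]
    · simpa [h1, h2] using measurableSet_lt (hm p) (hm m)

lemma j_mul_mem_strip (l m : Fin 3) (x : ℂ) :
    j * x ∈ strip c η δ (l + 1) (m + 1) ↔ x ∈ strip c η δ l m := by
  have : (∀ p, p ≠ l + 1 → p ≠ m + 1 → height p (j * x) < height (m + 1) (j * x)) ↔
      ∀ p, p ≠ l → p ≠ m → height p x < height m x := by
    rw [← forall_fin_three_add_one]
    simp only [height_j_mul, ne_eq, add_left_inj]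
  simp only [strip, Set.mem_ofPred_eq, this]
  simp only [height_j_mul, cost_j_mul, j_mul_mem_triangle]

lemma volume_strip_add_one (l m : Fin 3) :
    volume (strip c η δ (l + 1) (m + 1)) = volume (strip c η δ l m) := by
  rw [← measurePreserving_j_mul.measure_preimage_emb measurableEmbedding_j_mul]
  congr 1
  ext x
  exact j_mul_mem_strip l m x

/-- Near a point of the common boundary of two cells where the costs are continuous and positive,
the strips have positive area. -/
lemma volume_strip_pos {m : Fin 3} (hm : m ≠ 0) {y : ℂ} (hy : y ∈ triangle)
    (hym : height m y = height 0 y) (hyp : ∀ p, p ≠ 0 → p ≠ m → height p y < height m y)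
    (hc₀ : ContinuousWithinAt (cost c 0) triangle y)
    (hcm : ContinuousWithinAt (cost c m) triangle y) (hcost : cost c m y = cost c 0 y)
    (hη : 0 < η) (hδ : δ < cost c 0 y) : 0 < volume (strip c η δ 0 m) := by
  have hr := circumradius_pos
  have hev : ∀ᶠ x in 𝓝[triangle] y, cost c m x < cost c 0 x + η ∧ δ < cost c 0 x := by
    refine Filter.Eventually.and ?_ (hc₀.eventually (lt_mem_nhds hδ))
    exact hcm.eventually_lt (hc₀.add continuousWithinAt_const)
      (by rw [hcost]; exact lt_add_of_pos_right _ hη)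
  obtain ⟨N, hN, hyN, hNT⟩ := mem_nhdsWithin.1 hev
  set O : Set ℂ := {x | ∀ l, -(circumradius / 2) < height l x} ∩
    ({x | height m x < height 0 x} ∩
      ⋂ p, {x | p ≠ 0 → p ≠ m → height p x < height m x}) with hO
  have hOo : IsOpen O := by
    have hcont := continuous_height
    refine IsOpen.inter ?_ (IsOpen.inter (isOpen_lt (hcont _) (hcont _)) ?_)
    · rw [Set.ofPred_forall]
      exact isOpen_iInter_of_finite fun l => isOpen_lt continuous_const (hcont l)
    · refine isOpen_iInter_of_finite fun p => ?_
      by_cases h1 : p = 0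
      · simp [h1]
      · by_cases h2 : p = m
        · simp [h2]
        · simpa [h1, h2] using isOpen_lt (hcont p) (hcont m)
  have hsub : N ∩ O ⊆ strip c η δ 0 m := by
    rintro x ⟨hxN, hx1, hx2, hx3⟩
    have hxT : x ∈ triangle := mem_triangle_iff.2 fun l => (hx1 l).le
    obtain ⟨h1, h2⟩ := hNT ⟨hxN, hxT⟩
    exact ⟨hxT, hx2, fun p => Set.mem_iInter.1 hx3 p, h1.le, h2.le⟩
  refine lt_of_lt_of_le ((hN.inter hOo).measure_pos volume ?_) (measure_mono hsub)
  -- An interior point with bins `0`, `m`, and the third in strictly decreasing order of height.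
  -- Because `y` may lie on the edge of the triangle, the open set is entered by moving slightly
  -- from `y` towards `z`: weak inequalities at `y` become strict.
  set z : ℂ := (1 / 2 : ℝ) • bin 0 + (1 / 4 : ℝ) • bin m with hz
  have hz0 : height 0 z = 3 * circumradius / 8 := by
    rw [hz, height_combo, height_bin_self, height_bin_of_ne hm.symm]; ring
  have hzm : height m z = 0 := by
    rw [hz, height_combo, height_bin_self, height_bin_of_ne hm]; ring
  have hzp : ∀ p, p ≠ 0 → p ≠ m → height p z = -(3 * circumradius / 8) := fun p h1 h2 => by
    rw [hz, height_combo, height_bin_of_ne h1, height_bin_of_ne h2]; ring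
  have hztri : ∀ l, -(circumradius / 2) < height l z := fun l => by
    by_cases h1 : l = 0
    · rw [h1, hz0]; linarith
    · by_cases h2 : l = m
      · rw [h2, hzm]; linarith
      · rw [hzp l h1 h2]; linarith
  have htend : Tendsto (fun t : ℝ => (1 - t) • y + t • z) (𝓝[>] 0) (𝓝 y) := by
    have : Tendsto (fun t : ℝ => (1 - t) • y + t • z) (𝓝 0) (𝓝 ((1 - (0 : ℝ)) • y + (0 : ℝ) • z)) :=
      Continuous.tendsto (by fun_prop) 0
    simp only [sub_zero, one_smul, zero_smul, add_zero] at this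
    exact this.mono_left nhdsWithin_le_nhds
  obtain ⟨t, htN, ht0, ht1⟩ := ((htend.eventually (hN.mem_nhds hyN)).and
    (Ioo_mem_nhdsGT (show (0 : ℝ) < 1 by norm_num))).exists
  have hcombo := fun l => height_combo l (1 - t) t y z
  refine ⟨_, htN, fun l => ?_, ?_, Set.mem_iInter.2 fun p h1 h2 => ?_⟩
  · rw [hcombo]
    nlinarith [mem_triangle_iff.1 hy l, hztri l]
  · change height m _ < height 0 _
    rw [hcombo, hcombo, hym, hzm, hz0]
    have : 0 < t * (3 * circumradius / 8) := by positivity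
    linarith
  · rw [hcombo, hcombo, hzm, hzp p h1 h2]
    have : 0 < t * (3 * circumradius / 8) := by positivity
    nlinarith [hyp p h1 h2]

/-- A point `y` of `D₁` with positive cost yields the strip between bins `0` and `1`; its rotation
`j² y`, on `D₃`, yields the one between `0` and `2`. Rotations produce the remaining four. -/
lemma exists_volume_strip_pos (hconj : ∀ x ∈ triangle, c (-j * (starRingEnd ℂ) x) = c x)
    (hlip : ∃ U : Set ℂ, IsOpen U ∧ ray 0 ∪ ray 2 ⊆ U ∧
      ∃ K : NNReal, LipschitzOnWith K c (U ∩ triangle))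
    (hpos : ∃ x ∈ triangle ∩ ray 0, 0 < c x) :
    ∃ δ > 0, ∀ η > 0, ∀ l m, l ≠ m → 0 < volume (strip c η δ l m) := by
  obtain ⟨y, ⟨hyT, hyr⟩, hcy⟩ := hpos
  obtain ⟨U, hU, hrU, K, hK⟩ := hlip
  have hcont : ∀ x ∈ triangle, x ∈ ray 0 ∪ ray 2 → ContinuousWithinAt c triangle x :=
    fun x hx hxr => (hK.continuousOn x ⟨hrU hxr, hx⟩).mono_of_mem_nhdsWithin
      (inter_mem (mem_nhdsWithin_of_mem_nhds (hU.mem_nhds (hrU hxr))) self_mem_nhdsWithin)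
  have hyT2 : j ^ 2 * y ∈ triangle := j_sq_mul_mem_triangle.2 hyT
  obtain ⟨hy01, hy2⟩ := mem_ray_zero_iff.1 hyr
  have hsum := height_sum y
  have h2 : ∀ l, height (l + 2) (j ^ 2 * y) = height l y := fun l => by
    rw [show l + 2 = l + 1 + 1 by rw [add_assoc]; rfl, sq, mul_assoc, height_j_mul, height_j_mul]
  have hj2 : ∀ l, cost c (l + 2) (j ^ 2 * y) = cost c l y := fun l => by
    rw [show l + 2 = l + 1 + 1 by rw [add_assoc]; rfl, sq, mul_assoc, cost_j_mul, cost_j_mul]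
  have h20 : height 2 (j ^ 2 * y) = height 0 y := h2 0
  have h21 : height 0 (j ^ 2 * y) = height 1 y := h2 1
  have h22 : height 1 (j ^ 2 * y) = height 2 y := h2 2
  have hyr2 : j ^ 2 * y ∈ ray 2 := mem_ray_two_iff.2 ⟨by linarith, by linarith⟩
  have hc01 : cost c 1 y = cost c 0 y := cost_eq_cost hconj 0 1 y hyT hy01.symm
  have hc20 : cost c 2 (j ^ 2 * y) = cost c 0 y := hj2 0
  have hc21 : cost c 0 (j ^ 2 * y) = cost c 1 y := hj2 1
  have hjy : j * (j ^ 2 * y) = y := by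
    rw [← mul_assoc, show j * j ^ 2 = j ^ 3 by ring, j_cube, one_mul]
  -- The cost for bin `1` near `y ∈ D₁` is `c` near `j² y ∈ D₃`, so regularity of `c` is needed
  -- around both rays.
  have hC1 : ContinuousWithinAt (cost c 1) triangle y :=
    ContinuousWithinAt.comp (f := fun x => j ^ 2 * x) (g := c) (t := triangle)
      (hcont _ hyT2 (Or.inr hyr2)) (by fun_prop) fun x hx => j_sq_mul_mem_triangle.2 hx
  have hC2 : ContinuousWithinAt (cost c 2) triangle (j ^ 2 * y) :=
    ContinuousWithinAt.comp (f := fun x => j * x) (g := c) (t := triangle)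
      (by simpa only [hjy] using hcont y hyT (Or.inl hyr)) (by fun_prop)
      fun x hx => j_mul_mem_triangle.2 hx
  have hcy' : 0 < cost c 0 y := hcy
  -- This `δ` is chosen before `η`, which is what later allows `η / δ` to be made small.
  refine ⟨cost c 0 y / 2, half_pos hcy', fun η hη => ?_⟩
  have h01 : 0 < volume (strip c η (cost c 0 y / 2) 0 1) := by
    refine volume_strip_pos (by decide) hyT hy01.symm (fun p hp hp1 => ?_)
      (hcont y hyT (Or.inl hyr)) hC1 hc01 hη (by linarith)
    obtain rfl : p = 2 := by fin_cases p <;> simp_all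
    linarith
  have h02 : 0 < volume (strip c η (cost c 0 y / 2) 0 2) := by
    refine volume_strip_pos (by decide) hyT2 (by linarith) (fun p hp hp1 => ?_)
      (hcont _ hyT2 (Or.inr hyr2)) hC2 (by linarith) hη (by linarith)
    obtain rfl : p = 1 := by fin_cases p <;> simp_all
    linarith
  have hrot := fun l m => volume_strip_add_one (c := c) (η := η) (δ := cost c 0 y / 2) l m
  have h12 := (hrot 0 1).symm ▸ h01
  have h10 := (hrot 0 2).symm ▸ h02
  have h20 := (hrot 1 2).symm ▸ h12
  have h21 := (hrot 1 0).symm ▸ h10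
  intro l m hlm
  fin_cases l <;> fin_cases m <;> first | exact absurd rfl hlm | assumption

/-- On a strip of positive area inside cell `0` the cost is at least `δ`. Positivity of `σ` makes
the limiting maximum nondegenerate. -/
lemma sigmaSq_pos (hc : Measurable fun x : triangle => c x) {B : ℝ}
    (hB : ∀ x ∈ triangle, |c x| ≤ B) {η δ : ℝ} (hδ : 0 < δ) {m : Fin 3}
    (hvol : 0 < volume (strip c η δ 0 m)) : 0 < sigmaSq c := by
  have hfin : volume (cell 0) ≠ ⊤ :=
    ((measure_mono (cell_subset_triangle 0)).trans_lt (by rw [volume_triangle]; simp)).ne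
  have hcm : Measurable (triangle.indicator c) := measurable_cost_indicator hc 0
  have hint : IntegrableOn (fun x => c x ^ 2) (cell 0) := by
    have h1 : IntegrableOn (fun x => triangle.indicator c x ^ 2) (cell 0) := by
      refine Measure.integrableOn_of_bounded (M := B ^ 2) hfin
        (hcm.pow_const 2).aestronglyMeasurable ?_
      filter_upwards [ae_restrict_mem (measurableSet_cell 0)] with x hx
      rw [Set.indicator_of_mem hx.1.1, Real.norm_eq_abs, abs_pow]
      exact pow_le_pow_left₀ (abs_nonneg _) (hB x hx.1.1) 2
    refine h1.congr_fun (fun x hx => ?_) (measurableSet_cell 0)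
    simp only [Set.indicator_of_mem hx.1.1]
  have hsub := strip_subset_cell (c := c) (η := η) (δ := δ) 0 m
  have hsfin : volume (strip c η δ 0 m) ≠ ⊤ := ((measure_mono hsub).trans_lt hfin.lt_top).ne
  calc 0 < δ ^ 2 * volume.real (strip c η δ 0 m) :=
        mul_pos (by positivity) (ENNReal.toReal_pos hvol.ne' hsfin)
    _ = ∫ _ in strip c η δ 0 m, δ ^ 2 := by rw [setIntegral_const, smul_eq_mul, mul_comm]
    _ ≤ ∫ x in strip c η δ 0 m, c x ^ 2 := by
        refine setIntegral_mono_on (integrableOn_const hsfin) (hint.mono_set hsub)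
          (measurableSet_strip hc 0 m) fun x hx => ?_
        have : δ ≤ c x := hx.2.2.2.2
        exact pow_le_pow_left₀ hδ.le this 2
    _ ≤ sigmaSq c :=
        setIntegral_mono_set hint (ae_of_all _ fun x => sq_nonneg _) hsub.eventuallyLE

end Strip

/-! ### Pointwise bound for the optimality gap -/

section OptimalLoad

variable {c : ℂ → ℝ} {n : ℕ} {x : Fin n → ℂ}

lemma sum_cellMatrix_mul_cost (l : Fin 3) :
    ∑ k, cellMatrix x k l * cost c l (x k) = ∑ k, cellCost c l (x k) := by
  refine Finset.sum_congr rfl fun k _ => ?_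
  by_cases h : x k ∈ cell l <;> simp [cellMatrix, cellCost, h]

lemma load_eq_max (A : Matrix (Fin n) (Fin 3) ℝ) :
    load c A x = max (max (∑ k, A k 0 * cost c 0 (x k)) (∑ k, A k 1 * cost c 1 (x k)))
      (∑ k, A k 2 * cost c 2 (x k)) :=
  sup'_univ_three _

lemma suboptimalLoad_eq_max :
    suboptimalLoad c x = max (max (∑ k, cellCost c 0 (x k)) (∑ k, cellCost c 1 (x k)))
      (∑ k, cellCost c 2 (x k)) := by
  simp_rw [suboptimalLoad, load_eq_max, sum_cellMatrix_mul_cost]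

lemma optimalLoad_congr {c' : ℂ → ℝ} (h : ∀ l k, cost c l (x k) = cost c' l (x k)) :
    optimalLoad c x = optimalLoad c' x := by
  simp only [optimalLoad, load, h]

lemma measurable_optimalLoad (hc : ∀ l, Measurable (cost c l)) :
    Measurable fun x : Fin n → ℂ => optimalLoad c x := by
  refine Measurable.sInf allocations_finite.countable fun A _ => ?_
  change Measurable fun x : Fin n → ℂ => load c A x
  simp only [load_eq_max]
  fun_prop

lemma mean_le_optimalLoad (hx : ∀ k, x k ∈ triangle)
    (hconj : ∀ x ∈ triangle, c (-j * (starRingEnd ℂ) x) = c x)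
    (hnear : ∀ x ∈ triangle, ∀ l : Fin 3, l ≠ 0 → ‖x - bin 0‖ < ‖x - bin l‖ →
      cost c 0 x < cost c l x) :
    (∑ k, cellCost c 0 (x k) + ∑ k, cellCost c 1 (x k) + ∑ k, cellCost c 2 (x k)) / 3 ≤
      optimalLoad c x := by
  have h := sum_div_three_le_optimalLoad (c := c) (cellMatrix_mem_allocations hx) fun k l hl m =>
    cost_le_cost hconj hnear (x := x k) (by simpa [cellMatrix] using hl) m
  simpa only [Fin.sum_univ_three, sum_cellMatrix_mul_cost] using h

lemma cellCost_nonneg (h0 : ∀ x ∈ triangle, 0 ≤ c x) (l : Fin 3) (x : ℂ) : 0 ≤ cellCost c l x := by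
  refine Set.indicator_nonneg (fun y hy => ?_) x
  obtain ⟨z, hz, hzy⟩ := cost_mem_image (c := c) l hy.1.1
  exact hzy ▸ h0 z hz

lemma cost_le {B : ℝ} (hB : ∀ x ∈ triangle, c x ≤ B) (l : Fin 3) {x : ℂ} (hx : x ∈ triangle) :
    cost c l x ≤ B := by
  obtain ⟨z, hz, hzy⟩ := cost_mem_image (c := c) l hx
  exact hzy ▸ hB z hz

lemma cellCost_le {B : ℝ} (hB0 : 0 ≤ B) (hB : ∀ x ∈ triangle, c x ≤ B) (l : Fin 3) (x : ℂ) :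
    cellCost c l x ≤ B :=
  Set.indicator_le' (fun _ hy => cost_le hB l hy.1.1) (fun _ _ => hB0) x

/-- The gap between the optimal load and the mean of the loads of the cells, in terms of the
fluctuations of these loads and of the numbers of objects in the strips. -/
theorem optimalLoad_sub_mean_le (hn : 0 < n) (hx : ∀ k, x k ∈ triangle)
    (h0 : ∀ x ∈ triangle, 0 ≤ c x) {B : ℝ} (hB0 : 0 ≤ B) (hB : ∀ x ∈ triangle, c x ≤ B)
    {η δ p γ : ℝ} (hη : 0 ≤ η) (hδ : 0 < δ) (hp : 0 < p) {q : Fin 3 → Fin 3 → ℝ}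
    (hq : ∀ l m, l ≠ m → p ≤ q l m) {S : Fin 3 → ℝ} (hS : ∀ l, S l = ∑ k, cellCost c l (x k))
    {N : Fin 3 → Fin 3 → ℝ}
    (hN : ∀ l m, N l m = ∑ k, (strip c η δ l m).indicator (fun _ => (1 : ℝ)) (x k)) :
    optimalLoad c x - (S 0 + S 1 + S 2) / 3 ≤ 3 * (B + η * B / δ) +
      η / δ * √(2 * ∑ l, (S l - n * γ) ^ 2) + (4 / (3 * δ * p) + 4 * B / p ^ 2) *
        ((∑ l, (S l - n * γ) ^ 2 + ∑ l, ∑ m, (N l m - n * q l m) ^ 2) / n) := by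
  classical
  set H := ∑ l, (S l - n * γ) ^ 2 with hH
  have hH0 : 0 ≤ H := Finset.sum_nonneg fun l _ => sq_nonneg _
  -- Dominates every difference `S l - S m`, since `(a - b)² ≤ 2 (a² + b²)`.
  set M := √(2 * H) with hMdef
  have hM0 : 0 ≤ M := Real.sqrt_nonneg _
  have hMsq : M ^ 2 = 2 * H := Real.sq_sqrt (by positivity)
  have hn' : (0 : ℝ) < n := by exact_mod_cast hn
  have hSM : ∀ l m, S l - S m ≤ M := fun l m => by
    refine Real.le_sqrt_of_sq_le ?_
    by_cases hlm : l = m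
    · subst hlm; simp [hH0]
    · have : (S l - n * γ) ^ 2 + (S m - n * γ) ^ 2 ≤ H := by
        rw [← Finset.sum_pair hlm (f := fun l => (S l - n * γ) ^ 2)]
        exact Finset.sum_le_sum_of_subset_of_nonneg (Finset.subset_univ _)
          fun _ _ _ => sq_nonneg _
      nlinarith [sq_nonneg (S l - n * γ + (S m - n * γ))]
  have hA := cellMatrix_mem_allocations hx
  have hS' : ∀ l, ∑ k, cellMatrix x k l * cost c l (x k) = S l := fun l => by
    rw [sum_cellMatrix_mul_cost, hS]
  have hNcard : ∀ l m,
      N l m = (Finset.univ.filter fun k => x k ∈ strip c η δ l m).card := fun l m => by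
    rw [hN, Finset.card_filter]
    push_cast
    exact Finset.sum_congr rfl fun k _ => by simp [Set.indicator_apply]
  set Q := ∑ l, ∑ m, (N l m - n * q l m) ^ 2 with hQ
  have hQ0 : 0 ≤ Q := Finset.sum_nonneg fun l _ => Finset.sum_nonneg fun m _ => sq_nonneg _
  by_cases hgood : ∀ l m, l ≠ m → M / 3 ≤ δ * N l m
  · obtain ⟨A, hAmem, hAle⟩ := exists_rebalanced_allocation hA (a := fun l k => cost c l (x k))
      (R := fun l m => Finset.univ.filter fun k => x k ∈ strip c η δ l m) (B := B) (η := η)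
      (δ := δ) (M := M)
      (fun l m k hk => by
        have hk := (Finset.mem_filter.1 hk).2
        refine ⟨?_, ne_of_mem_strip hk⟩
        simp [cellMatrix, strip_subset_cell l m hk])
      (fun l m m' k hk hk' =>
        eq_of_mem_strip (Finset.mem_filter.1 hk).2 (Finset.mem_filter.1 hk').2)
      hB0 hη hδ (fun l k => cost_le hB l (hx k))
      (fun l m k hk => (Finset.mem_filter.1 hk).2.2.2.2.2)
      (fun l m k hk => (Finset.mem_filter.1 hk).2.2.2.2.1)
      (fun l m => by rw [hS', hS']; exact hSM l m)
      (fun l m hlm => by rw [← hNcard]; exact hgood l m hlm)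
    have hload : load c A x ≤ (S 0 + S 1 + S 2) / 3 + 3 * (B + η * ((M / 3 + B) / δ)) := by
      refine Finset.sup'_le _ _ fun l _ => ?_
      simpa only [hS', Fin.sum_univ_three] using hAle l
    have hle := (optimalLoad_le (c := c) (x := x) hAmem).trans hload
    have hpos : 0 ≤ (4 / (3 * δ * p) + 4 * B / p ^ 2) * ((H + Q) / n) := by positivity
    have heq : 3 * (B + η * ((M / 3 + B) / δ)) = 3 * (B + η * B / δ) + η / δ * M := by
      field_simp; ring
    linarith
  -- Some strip holds too few objects to rebalance. The suboptimal allocation bounds the gap by `M`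
  -- and by `n B`, and one of these is absorbed by the quadratic terms `H / n` and `Q / n`.
  · push Not at hgood
    obtain ⟨l, m, hlm, hbad⟩ := hgood
    have hsub : optimalLoad c x ≤ max (max (S 0) (S 1)) (S 2) := by
      rw [hS, hS, hS, ← suboptimalLoad_eq_max]
      exact optimalLoad_le hA
    have hDM : optimalLoad c x - (S 0 + S 1 + S 2) / 3 ≤ M := by
      have hmax : max (max (S 0) (S 1)) (S 2) ≤ (S 0 + S 1 + S 2) / 3 + M :=
        max_le (max_le (by linarith [hSM 0 1, hSM 0 2]) (by linarith [hSM 1 0, hSM 1 2]))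
          (by linarith [hSM 2 0, hSM 2 1])
      linarith
    have hDn : optimalLoad c x - (S 0 + S 1 + S 2) / 3 ≤ n * B := by
      have hSn : ∀ l, S l ≤ n * B := fun l => by
        rw [hS]
        refine (Finset.sum_le_card_nsmul _ _ B fun k _ => cellCost_le hB0 hB l (x k)).trans ?_
        simp
      have hS0 : ∀ l, 0 ≤ S l := fun l => by
        rw [hS]; exact Finset.sum_nonneg fun k _ => cellCost_nonneg h0 l _
      linarith [max_le (max_le (hSn 0) (hSn 1)) (hSn 2), hS0 0, hS0 1, hS0 2]
    have hlead : 0 ≤ 3 * (B + η * B / δ) + η / δ * M := by positivity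
    have hqp := hq l m hlm
    rcases le_or_gt (n * p / 2) (N l m) with hcase | hcase
    -- The strip is well filled, so `M` itself is of order `n`; then `M = M² / M ≤ 4 H / (3 δ p n)`.
    · have hMlow : 3 * δ * p * n / 2 ≤ M := by nlinarith
      have h1 : M ≤ 4 / (3 * δ * p) * (H / n) := by
        rw [div_mul_div_comm, le_div_iff₀ (by positivity)]
        nlinarith
      have h2 : 4 / (3 * δ * p) * (H / n) ≤
          (4 / (3 * δ * p) + 4 * B / p ^ 2) * ((H + Q) / n) := by
        gcongr
        · exact le_add_of_nonneg_right (by positivity)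
        · linarith
      linarith
    · have hterm : (N l m - n * q l m) ^ 2 ≤ Q :=
        (Finset.single_le_sum (f := fun m => (N l m - n * q l m) ^ 2) (fun _ _ => sq_nonneg _)
          (Finset.mem_univ m)).trans (Finset.single_le_sum
            (f := fun l => ∑ m, (N l m - n * q l m) ^ 2)
            (fun _ _ => Finset.sum_nonneg fun _ _ => sq_nonneg _) (Finset.mem_univ l))
      -- The strip holds less than half of the minimal expected number `n p`, so its count deviates
      -- by at least `n p / 2`, and `n B ≤ (4 B / p²) Q / n`.
      have hQlow : (n * p / 2) ^ 2 ≤ Q := by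
        refine le_trans ?_ hterm
        rw [← neg_sq (N l m - n * q l m)]
        refine pow_le_pow_left₀ (by positivity) ?_ 2
        nlinarith
      have h1 : n * B ≤ 4 * B / p ^ 2 * (Q / n) := by
        rw [div_mul_div_comm, le_div_iff₀ (by positivity)]
        nlinarith [mul_le_mul_of_nonneg_left hQlow hB0]
      have h2 : 4 * B / p ^ 2 * (Q / n) ≤
          (4 / (3 * δ * p) + 4 * B / p ^ 2) * ((H + Q) / n) := by
        gcongr
        · exact le_add_of_nonneg_left (by positivity)
        · linarith
      linarith

end OptimalLoad

/-! ### Expected optimality gap -/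

section Expectation

instance isProbabilityMeasure_restrict_triangle :
    IsProbabilityMeasure (volume.restrict triangle) :=
  ⟨by rw [Measure.restrict_apply_univ, volume_triangle]⟩

variable {c : ℂ → ℝ} {Ω : Type*} [MeasurableSpace Ω] {P : Measure Ω} {X : ℕ → Ω → ℂ}

lemma hasLaw_of_isUniform {Y : Ω → ℂ} (hY : Measurable Y)
    (hu : pdf.IsUniform Y triangle P volume) : HasLaw Y (volume.restrict triangle) P where
  aemeasurable := hY.aemeasurable
  map_eq := by
    have := hu
    rw [pdf.IsUniform, ProbabilityTheory.cond, volume_triangle, inv_one, one_smul] at this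
    exact this

lemma ae_forall_mem_triangle (hX : ∀ k, HasLaw (X k) (volume.restrict triangle) P) :
    ∀ᵐ ω ∂P, ∀ k, X k ω ∈ triangle := by
  refine ae_all_iff.2 fun k => ?_
  refine ae_of_ae_map (hX k).aemeasurable ?_
  rw [(hX k).map_eq]
  exact ae_restrict_mem measurableSet_triangle

lemma memLp_cellCost (hc : Measurable fun x : triangle => c x) (h0 : ∀ x ∈ triangle, 0 ≤ c x)
    {B : ℝ} (hB0 : 0 ≤ B) (hB : ∀ x ∈ triangle, c x ≤ B) (l : Fin 3) :
    MemLp (cellCost c l) 2 (volume.restrict triangle) :=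
  MemLp.of_bound (measurable_cellCost hc l).aestronglyMeasurable B <| ae_of_all _ fun x => by
    rw [Real.norm_eq_abs, abs_of_nonneg (cellCost_nonneg h0 l x)]
    exact cellCost_le hB0 hB l x

variable [IsProbabilityMeasure P]

lemma integrable_optimalLoad (hc : Measurable fun x : triangle => c x)
    (h0 : ∀ x ∈ triangle, 0 ≤ c x) {B : ℝ} (hB0 : 0 ≤ B) (hB : ∀ x ∈ triangle, c x ≤ B)
    (hconj : ∀ x ∈ triangle, c (-j * (starRingEnd ℂ) x) = c x)
    (hnear : ∀ x ∈ triangle, ∀ l : Fin 3, l ≠ 0 → ‖x - bin 0‖ < ‖x - bin l‖ →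
      cost c 0 x < cost c l x)
    (hX : ∀ k, HasLaw (X k) (volume.restrict triangle) P) (n : ℕ) :
    Integrable (fun ω => optimalLoad c fun k : Fin n => X k ω) P := by
  have hmem := ae_forall_mem_triangle hX
  have hm : AEMeasurable (fun ω => optimalLoad c fun k : Fin n => X k ω) P := by
    have h1 : AEMeasurable
        (fun ω => optimalLoad (triangle.indicator c) fun k : Fin n => X k ω) P :=
      (measurable_optimalLoad (measurable_cost_indicator hc)).comp_aemeasurable
        (aemeasurable_pi_lambda _ fun k => (hX k).aemeasurable)
    refine h1.congr ?_
    filter_upwards [hmem] with ω hω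
    exact optimalLoad_congr fun l k => cost_indicator l (hω k)
  refine Integrable.of_bound hm.aestronglyMeasurable (n * B) ?_
  filter_upwards [hmem] with ω hω
  have hsum : ∀ l, 0 ≤ ∑ k : Fin n, cellCost c l (X k ω) ∧
      ∑ k : Fin n, cellCost c l (X k ω) ≤ n * B := fun l =>
    ⟨Finset.sum_nonneg fun k _ => cellCost_nonneg h0 l _,
      (Finset.sum_le_card_nsmul _ _ B fun k _ => cellCost_le hB0 hB l _).trans (by simp)⟩
  have hlow := mean_le_optimalLoad (x := fun k : Fin n => X k ω) (fun k => hω k) hconj hnear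
  have hup : optimalLoad c (fun k : Fin n => X k ω) ≤ n * B := by
    refine (optimalLoad_le (cellMatrix_mem_allocations fun k => hω k)).trans ?_
    change suboptimalLoad c _ ≤ _
    rw [suboptimalLoad_eq_max]
    exact max_le (max_le (hsum 0).2 (hsum 1).2) (hsum 2).2
  rw [Real.norm_eq_abs, abs_of_nonneg]
  · exact hup
  · linarith [(hsum 0).1, (hsum 1).1, (hsum 2).1]

/-- The optimal load exceeds the mean of the loads of the cells by `o(√n)` on average. -/
theorem isLittleO_integral_optimalLoad_sub_mean (hc : Measurable fun x : triangle => c x)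
    (h0 : ∀ x ∈ triangle, 0 ≤ c x) {B : ℝ} (hB0 : 0 ≤ B) (hB : ∀ x ∈ triangle, c x ≤ B)
    (hconj : ∀ x ∈ triangle, c (-j * (starRingEnd ℂ) x) = c x)
    (hnear : ∀ x ∈ triangle, ∀ l : Fin 3, l ≠ 0 → ‖x - bin 0‖ < ‖x - bin l‖ →
      cost c 0 x < cost c l x)
    {δ : ℝ} (hδ : 0 < δ) (hvol : ∀ η > 0, ∀ l m, l ≠ m → 0 < volume (strip c η δ l m))
    (hX : ∀ k, HasLaw (X k) (volume.restrict triangle) P) (hXi : iIndepFun X P)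
    {S : Fin 3 → ℕ → Ω → ℝ}
    (hS : ∀ l n ω, S l n ω = ∑ k ∈ Finset.range n, cellCost c l (X k ω)) :
    (fun n : ℕ => ∫ ω, ((optimalLoad c fun k : Fin n => X k ω) -
      (S 0 n ω + S 1 n ω + S 2 n ω) / 3) ∂P) =o[atTop] fun n : ℕ => √(n : ℝ) := by
  set ν : Measure ℂ := volume.restrict triangle with hν
  have hmem := ae_forall_mem_triangle hX
  have hγ : ∀ l, ∫ x, cellCost c l x ∂ν = gammaConst c := fun l => by
    simpa [gammaConst] using setIntegral_cellCost_pow (c := c) one_ne_zero l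
  have hfL := memLp_cellCost hc h0 hB0 hB
  have hSL : ∀ l n, MemLp (S l n) 2 P := fun l n => by
    simpa only [← hS] using memLp_sum_comp hX (hfL l) n
  have hSfin : ∀ l n ω, S l n ω = ∑ k : Fin n, cellCost c l (X k ω) := fun l n ω => by
    rw [hS, Finset.sum_range]
  set V := ∑ l, Var[cellCost c l; ν] with hV
  have hV0 : 0 ≤ V := Finset.sum_nonneg fun l _ => variance_nonneg _ _
  set D : ℕ → Ω → ℝ := fun n ω => (optimalLoad c fun k : Fin n => X k ω) -
    (S 0 n ω + S 1 n ω + S 2 n ω) / 3 with hD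
  have hD0 : ∀ n, 0 ≤ ∫ ω, D n ω ∂P := fun n => by
    refine integral_nonneg_of_ae ?_
    filter_upwards [hmem] with ω hω
    simp only [hD, hSfin, Pi.zero_apply]
    linarith [mean_le_optimalLoad (x := fun k : Fin n => X k ω) (fun k => hω k) hconj hnear]
  have hDint : ∀ n, Integrable (D n) P := fun n => by
    refine (integrable_optimalLoad hc h0 hB0 hB hconj hnear hX n).sub ?_
    have hint := fun l => (hSL l n).integrable (q := 2) (by simp)
    exact (((hint 0).add (hint 1)).add (hint 2)).div_const 3
  -- `K` may depend on `η`, through the areas of the strips, but `V` does not.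
  have key : ∀ η > 0, ∃ K : ℝ, ∀ n : ℕ, 0 < n →
      ∫ ω, D n ω ∂P ≤ K + η / δ * (V + 1 / 2) * √(n : ℝ) := by
    intro η hη
    set f : Fin 3 → Fin 3 → ℂ → ℝ := fun l m => (strip c η δ l m).indicator fun _ => 1 with hf
    have hfm : ∀ l m, Measurable (f l m) := fun l m =>
      measurable_const.indicator (measurableSet_strip hc l m)
    have hfL : ∀ l m, MemLp (f l m) 2 ν := fun l m =>
      MemLp.of_bound (hfm l m).aestronglyMeasurable 1 (ae_of_all _ fun x => by
        by_cases h : x ∈ strip c η δ l m <;> simp [hf, h])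
    set q : Fin 3 → Fin 3 → ℝ := fun l m => ∫ x, f l m x ∂ν with hq
    have hqpos : ∀ l m, l ≠ m → 0 < q l m := fun l m hlm => by
      simp only [hq, hf]
      rw [integral_indicator_const _ (measurableSet_strip hc l m), smul_eq_mul, mul_one,
        measureReal_restrict_apply (measurableSet_strip hc l m), Set.inter_eq_left.2
          ((strip_subset_cell l m).trans (cell_subset_triangle l))]
      refine ENNReal.toReal_pos (hvol η hη l m hlm).ne' ?_
      refine ((measure_mono ((strip_subset_cell l m).trans (cell_subset_triangle l))).trans_lt
        ?_).ne
      rw [volume_triangle]; simp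
    -- A positive lower bound for the off-diagonal areas. The diagonal strips are empty, so the
    -- dummy value `1` keeps them out of the minimum.
    obtain ⟨⟨l₀, m₀⟩, hmin⟩ := Finite.exists_min
      fun i : Fin 3 × Fin 3 => if i.1 = i.2 then (1 : ℝ) else q i.1 i.2
    set p : ℝ := if l₀ = m₀ then (1 : ℝ) else q l₀ m₀ with hp
    have hp0 : 0 < p := by
      by_cases h : l₀ = m₀
      · simp [hp, h]
      · simpa [hp, h] using hqpos l₀ m₀ h
    have hpq : ∀ l m, l ≠ m → p ≤ q l m := fun l m hlm => by
      simpa [hp, hlm] using hmin (l, m)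
    set N : Fin 3 → Fin 3 → ℕ → Ω → ℝ := fun l m n ω => ∑ k ∈ Finset.range n, f l m (X k ω) with hN
    have hNL : ∀ l m n, MemLp (N l m n) 2 P := fun l m n => memLp_sum_comp hX (hfL l m) n
    set V' := ∑ l, ∑ m, Var[f l m; ν] with hV'
    set C := 4 / (3 * δ * p) + 4 * B / p ^ 2 with hC
    refine ⟨3 * (B + η * B / δ) + C * (V + V'), fun n hn => ?_⟩
    have hn' : (0 : ℝ) < n := by exact_mod_cast hn
    have hsq : 0 < √(n : ℝ) := by positivity
    set H : Ω → ℝ := fun ω => ∑ l, (S l n ω - n * gammaConst c) ^ 2 with hH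
    set Q : Ω → ℝ := fun ω => ∑ l, ∑ m, (N l m n ω - n * q l m) ^ 2 with hQ
    have hHi : ∀ l, Integrable (fun ω => (S l n ω - n * gammaConst c) ^ 2) P := fun l =>
      ((hSL l n).sub (memLp_const _)).integrable_sq
    have hQi : ∀ l m, Integrable (fun ω => (N l m n ω - n * q l m) ^ 2) P := fun l m =>
      ((hNL l m n).sub (memLp_const _)).integrable_sq
    have hHint : Integrable H P := integrable_finsetSum _ fun l _ => hHi l
    have hQint : Integrable Q P :=
      integrable_finsetSum _ fun l _ => integrable_finsetSum _ fun m _ => hQi l m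
    have hHE : ∫ ω, H ω ∂P = n * V := by
      rw [integral_finsetSum _ fun l _ => hHi l, hV, Finset.mul_sum]
      refine Finset.sum_congr rfl fun l _ => ?_
      rw [← integral_sq_sum_comp_sub hX hXi (measurable_cellCost hc l)
        (memLp_cellCost hc h0 hB0 hB l) n, hγ]
      simp_rw [hS]
    have hQE : ∫ ω, Q ω ∂P = n * V' := by
      rw [integral_finsetSum _ fun l _ => integrable_finsetSum _ fun m _ => hQi l m, hV',
        Finset.mul_sum]
      refine Finset.sum_congr rfl fun l _ => ?_
      rw [integral_finsetSum _ fun m _ => hQi l m, Finset.mul_sum]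
      exact Finset.sum_congr rfl fun m _ => integral_sq_sum_comp_sub hX hXi (hfm l m) (hfL l m) n
    have hpt : ∀ᵐ ω ∂P, D n ω ≤ 3 * (B + η * B / δ) + η / δ * √(n : ℝ) / 2 +
        η / δ / √(n : ℝ) * H ω + C / n * (H ω + Q ω) := by
      filter_upwards [hmem] with ω hω
      have h1 := optimalLoad_sub_mean_le (γ := gammaConst c) hn (fun k => hω k) h0 hB0 hB hη.le hδ
        hp0 hpq (S := fun l => S l n ω) (fun l => hSfin l n ω) (N := fun l m => N l m n ω)
        (fun l m => by simp only [hN]; rw [Finset.sum_range])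
      -- An arithmetic–geometric mean bound that is linear in `H`, so that only the mean `n V` of
      -- `H` is needed.
      have h2 : √(2 * H ω) ≤ √(n : ℝ) / 2 + H ω / √(n : ℝ) := by
        have hH0 : 0 ≤ H ω := Finset.sum_nonneg fun l _ => sq_nonneg _
        refine Real.sqrt_le_iff.2 ⟨by positivity, ?_⟩
        have h3 : √(n : ℝ) / 2 * (H ω / √(n : ℝ)) = H ω / 2 := by field_simp
        nlinarith [sq_nonneg (√(n : ℝ) / 2 - H ω / √(n : ℝ))]
      have h4 := mul_le_mul_of_nonneg_left h2 (show 0 ≤ η / δ by positivity)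
      have h5 : η / δ * (√(n : ℝ) / 2 + H ω / √(n : ℝ)) =
        η / δ * √(n : ℝ) / 2 + η / δ / √(n : ℝ) * H ω := by ring
      have h6 : C * ((H ω + Q ω) / n) = C / n * (H ω + Q ω) := by ring
      change D n ω ≤ 3 * (B + η * B / δ) + η / δ * √(2 * H ω) + C * ((H ω + Q ω) / n) at h1
      linarith
    have hint1 : Integrable (fun ω => 3 * (B + η * B / δ) + η / δ * √(n : ℝ) / 2 +
        η / δ / √(n : ℝ) * H ω) P := (integrable_const _).add (hHint.const_mul _)
    have hint2 : Integrable (fun ω => C / n * (H ω + Q ω)) P := (hHint.add hQint).const_mul _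
    have hE := integral_mono_ae (hDint n) (hint1.add hint2) hpt
    refine hE.trans_eq ?_
    rw [integral_add' hint1 hint2, integral_add (integrable_const _) (hHint.const_mul _),
      integral_const_mul, integral_const_mul, integral_add hHint hQint, hHE, hQE]
    simp only [integral_const, probReal_univ, one_smul]
    have hnn : (n : ℝ) = √(n : ℝ) * √(n : ℝ) := (Real.mul_self_sqrt hn'.le).symm
    have e1 : η / δ / √(n : ℝ) * (n * V) = η / δ * V * √(n : ℝ) := by
      rw [div_mul_eq_mul_div, div_eq_iff hsq.ne', hnn]
      simp only [Real.sqrt_mul_self hsq.le]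
      ring
    have e2 : C / n * (n * V + n * V') = C * (V + V') := by field_simp
    rw [e1, e2]
    ring
  rw [isLittleO_iff]
  intro ε hε
  -- This `η` makes the coefficient of `√n` equal to `ε / 2`; the constant `K` is below `(ε / 2) √n`
  -- once `√n ≥ 2 K / ε`.
  obtain ⟨K, hK⟩ := key (ε / 2 * δ / (V + 1 / 2)) (by positivity)
  have htend : Tendsto (fun n : ℕ => √(n : ℝ)) atTop atTop :=
    Real.tendsto_sqrt_atTop.comp tendsto_natCast_atTop_atTop
  filter_upwards [eventually_gt_atTop 0, htend.eventually_ge_atTop (2 * K / ε)] with n hn hnK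
  rw [Real.norm_of_nonneg (hD0 n), Real.norm_of_nonneg (Real.sqrt_nonneg _)]
  refine (hK n hn).trans ?_
  rw [div_le_iff₀ hε] at hnK
  have hcoef : ε / 2 * δ / (V + 1 / 2) / δ * (V + 1 / 2) = ε / 2 := by field_simp
  rw [hcoef]
  linarith

end Expectation

end PlanarLoad

/-! ### Assembly of the theorem -/

theorem theorem1p2
    -- the cost function: measurable, nonnegative and bounded on the triangle
    (c : ℂ → ℝ)
    (hc_meas : Measurable fun x : PlanarLoad.triangle => c x)
    (hc_nonneg : ∀ x ∈ PlanarLoad.triangle, 0 ≤ c x)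
    (hc_bdd : BddAbove (c '' PlanarLoad.triangle))
    -- a strictly nearer bin is strictly cheaper
    (hc_near : ∀ x ∈ PlanarLoad.triangle, ∀ l : Fin 3, l ≠ 0 →
      ‖x - PlanarLoad.bin 0‖ < ‖x - PlanarLoad.bin l‖ →
      PlanarLoad.cost c 0 x < PlanarLoad.cost c l x)
    -- reflection symmetry with respect to the line through `0` and `B₁`
    (hc_symm : ∀ θ ∈ Set.Icc (0 : ℝ) (2 * Real.pi), ∀ t : ℝ, 0 < t →
      (t : ℂ) * Complex.exp (Complex.I * θ) ∈ PlanarLoad.triangle →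
      c (t * Complex.exp (Complex.I * θ)) =
        c (t * Complex.exp (-(Complex.I * θ) - Complex.I * Real.pi / 3)))
    -- `c` is Lipschitz (on the triangle) in a neighbourhood of `D₁ ∪ D₃`
    (hc_lip : ∃ U : Set ℂ, IsOpen U ∧ PlanarLoad.ray 0 ∪ PlanarLoad.ray 2 ⊆ U ∧
      ∃ K : NNReal, LipschitzOnWith K c (U ∩ PlanarLoad.triangle))
    -- `c` is not identically zero on the common boundary of the first two cells
    (hc_pos : ∃ x ∈ PlanarLoad.triangle ∩ PlanarLoad.ray 0, 0 < c x)
    -- the positions: independent and uniformly distributed on the triangle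
    {Ω : Type*} [MeasurableSpace Ω] (P : Measure Ω) [IsProbabilityMeasure P]
    (X : ℕ → Ω → ℂ) (hX_meas : ∀ k, Measurable (X k))
    (hX_unif : ∀ k, pdf.IsUniform (X k) PlanarLoad.triangle P volume)
    (hX_indep : iIndepFun X P)
    -- the Gaussian variables `G` and `G₁, G₂, G₃` that describe the limits
    {Ω' : Type*} [MeasurableSpace Ω'] (P' : Measure Ω') [IsProbabilityMeasure P']
    (G : Ω' → ℝ) (Z : Fin 3 → Ω' → ℝ)
    (hG : HasLaw G (gaussianReal 0
      (PlanarLoad.sigmaSq c / 3 - PlanarLoad.gammaConst c ^ 2).toNNReal) P')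
    (hZ : ∀ i, HasLaw (Z i) (gaussianReal 0 (PlanarLoad.sigmaSq c).toNNReal) P')
    (hZ_indep : iIndepFun Z P')
    (hGZ_indep : IndepFun G (fun ω i => Z i ω) P') :
    let γ : ℝ := PlanarLoad.gammaConst c
    let ρ : ℕ → Ω → ℝ := fun n ω => PlanarLoad.optimalLoad c fun k : Fin n => X k ω
    let ρbar : ℕ → Ω → ℝ := fun n ω => PlanarLoad.suboptimalLoad c fun k : Fin n => X k ω
    let maxZ : Ω' → ℝ := fun ω => max (max (Z 0 ω) (Z 1 ω)) (Z 2 ω)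
    let meanZ : Ω' → ℝ := fun ω => (Z 0 ω + Z 1 ω + Z 2 ω) / 3
    let m : ℝ := ∫ ω, maxZ ω ∂P'
    -- the variance of `G` is a genuine one
    0 ≤ PlanarLoad.sigmaSq c / 3 - γ ^ 2 ∧
    -- convergence in distribution
    TendstoInDistribution (fun (n : ℕ) ω => (√(n : ℝ))⁻¹ * (ρ n ω - γ * n)) atTop
      G (fun _ => P) P' ∧
    TendstoInDistribution (fun (n : ℕ) ω => (√(n : ℝ))⁻¹ * (ρbar n ω - γ * n)) atTop
      (fun ω => maxZ ω - meanZ ω + G ω) (fun _ => P) P' ∧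
    TendstoInDistribution (fun (n : ℕ) ω => (√(n : ℝ))⁻¹ * (ρbar n ω - ρ n ω)) atTop
      (fun ω => maxZ ω - meanZ ω) (fun _ => P) P' ∧
    -- convergence of the means
    (∀ n, Integrable (ρ n) P) ∧ (∀ n, Integrable (ρbar n) P) ∧ Integrable maxZ P' ∧
    (fun n : ℕ => (∫ ω, ρ n ω ∂P) - n * γ) =o[atTop] (fun n : ℕ => √(n : ℝ)) ∧
    (fun n : ℕ => (∫ ω, ρbar n ω ∂P) - (n * γ + m * √(n : ℝ))) =o[atTop]
      (fun n : ℕ => √(n : ℝ)) ∧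
    -- `m` is positive and depends linearly on `σ`
    0 < m ∧ m = PlanarLoad.stdNormalMaxMean * √(PlanarLoad.sigmaSq c) := by
  intro γ ρ ρbar maxZ meanZ m
  obtain ⟨B', hB'⟩ := hc_bdd
  set B := max B' 0
  have hB0 : 0 ≤ B := le_max_right _ _
  have hB : ∀ x ∈ PlanarLoad.triangle, c x ≤ B := fun x hx =>
    (hB' ⟨x, hx, rfl⟩).trans (le_max_left _ _)
  have hconj := fun x hx => PlanarLoad.cost_conj hc_symm (x := x) hx
  obtain ⟨δ, hδ, hvol⟩ := PlanarLoad.exists_volume_strip_pos hconj hc_lip hc_pos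
  have hX := fun k => PlanarLoad.hasLaw_of_isUniform (hX_meas k) (hX_unif k)
  -- Any `η > 0` and either neighbouring bin would do; `η = 1` and bin `1` are arbitrary choices.
  have hσ : 0 < PlanarLoad.sigmaSq c := PlanarLoad.sigmaSq_pos hc_meas
    (fun x hx => by rw [abs_of_nonneg (hc_nonneg x hx)]; exact hB x hx) hδ
    (hvol 1 one_pos 0 1 (by decide))
  have hfm := PlanarLoad.measurable_cellCost hc_meas
  have hf := PlanarLoad.memLp_cellCost hc_meas hc_nonneg hB0 hB
  have hγ : ∀ l, ∫ x in PlanarLoad.triangle, PlanarLoad.cellCost c l x = γ := fun l => by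
    simpa [γ, PlanarLoad.gammaConst] using
      PlanarLoad.setIntegral_cellCost_pow (c := c) one_ne_zero l
  have hs : ∀ l, ∫ x in PlanarLoad.triangle, PlanarLoad.cellCost c l x ^ 2 =
      PlanarLoad.sigmaSq c := PlanarLoad.setIntegral_cellCost_pow two_ne_zero
  have horth : ∀ l m, l ≠ m → ∀ x, PlanarLoad.cellCost c l x * PlanarLoad.cellCost c m x = 0 :=
    fun l m hlm => PlanarLoad.cellCost_mul_cellCost hlm
  set S : Fin 3 → ℕ → Ω → ℝ := fun l n ω => ∑ k ∈ Finset.range n, PlanarLoad.cellCost c l (X k ω)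
  have hSfin : ∀ l n ω, S l n ω = ∑ k : Fin n, PlanarLoad.cellCost c l (X k ω) := fun l n ω =>
    Finset.sum_range _
  have hmem := PlanarLoad.ae_forall_mem_triangle hX
  have hρ := PlanarLoad.integrable_optimalLoad hc_meas hc_nonneg hB0 hB hconj hc_near hX
  obtain ⟨h1, h2, h3, h4, h5, h6⟩ := PlanarLoad.tendstoInDistribution_of_isLittleO hX hX_indep
    hfm hf hγ hs horth hG hZ hZ_indep hGZ_indep (ρ := ρ) (ρbar := ρbar) (S := S) (fun _ _ _ => rfl)
    (fun n => ae_of_all _ fun ω => by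
      simp only [ρbar, hSfin]
      exact PlanarLoad.suboptimalLoad_eq_max)
    hρ
    (fun n => by
      filter_upwards [hmem] with ω hω
      simp only [hSfin]
      exact PlanarLoad.mean_le_optimalLoad (x := fun k : Fin n => X k ω) (fun k => hω k)
        hconj hc_near)
    (PlanarLoad.isLittleO_integral_optimalLoad_sub_mean hc_meas hc_nonneg hB0 hB hconj
      hc_near hδ hvol hX hX_indep fun _ _ _ => rfl)
  exact ⟨PlanarLoad.sub_sq_nonneg_of_orthogonal hf hγ hs horth, h1, h2, h3, hρ, h4,
    (PlanarLoad.memLp_max_three fun i =>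
      PlanarLoad.memLp_two_of_hasLaw_gaussianReal (hZ i)).integrable
      (by simp), h5, h6,
    PlanarLoad.integral_max_three_pos (by simpa using hσ) hZ hZ_indep,
    PlanarLoad.integral_max_three_eq hσ.le hZ hZ_indep⟩
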